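/- Let $\mathbb F$ be a finite field with $q$ elements, $q$ odd, let $z\in\mathbb F$ be a non-square such that $1-z$ is a non-square, let $\nu\ge 0$ be an integer, and put $\Delta=\mathrm{diag}(1,-z)$ and $$S=\begin{pmatrix}0&I^{(\nu)}&0\\ I^{(\nu)}&0&0\\ 0&0&\Delta\end{pmatrix}.$$ Let $O=\{T\in GL_{2\nu+2}(\mathbb F): TST^t=S\}$ act on the subspaces of the row space $\mathbb F^{2\nu+2}$ by $P\mapsto PT$. A subspace $P$ is totally isotropic if $xSy^t=0$ for all $x,y\in P$. Let $\Gamma$ be the graph whose vertices are the maximal totally isotropic subspaces, two distinct vertices $P,Q$ being adjacent if and only if $\dim(P\cap Q)=\nu-1$. Write $(A\ \ B\ \ Z)$, with $A,B\in M_\nu(\mathbb F)$ and $Z\in M_{\nu 2}(\mathbb F)$, for the row space of this matrix. Let $P_0=(I\ \ 0\ \ 0)$ and $P_1=(0\ \ I\ \ 0)$, let $\Lambda$ be the set of vertices of $\Gamma$ at distance $\nu$ from $P_0$, and let $G_{01}$ be the stabilizer of both $P_0$ and $P_1$ in $O$. For $Q\in\Lambda$ let $\overline{Q}$ be the orbit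 of $Q$ under $G_{01}$; the trivial orbit is $\{P_1\}$. Let $[X_1,\dots,X_t]$ denote a block diagonal matrix, $0^{(m)}$ the $m\times m$ zero matrix, $\mathcal A_{2r}=[\mathcal A_2,\dots,\mathcal A_2]$ ($r$ blocks) with $\mathcal A_2=\begin{pmatrix}0&1\\-1&0\end{pmatrix}$, $\mathcal K=\begin{pmatrix}0&I^{(2)}\\-I^{(2)}&0\end{pmatrix}$, $Y=\begin{pmatrix}0&0&1\\0&0&1\\-1&-1&0\end{pmatrix}$, and let $E_i\in\mathbb F^\nu$ be the $i$-th standard column vector. Let $\Omega\subseteq\mathbb F^*$ be such that $\mathbb F^*=\Omega\cup-\Omega$. For $a\in\{0,1\}$ and $b\in\Omega$ put $$\begin{array}{ll} \varphi_1(r)=([\mathcal A_{2r},0^{(\nu-2r)}]\ \ I\ \ 0)&(1\le r,\ 2r\le\nu),\\ \varphi_2(r,a)=([-\tfrac12(1-za^2),\mathcal A_{2r},0^{(\nu-2r-1)}]\ \ I\ \ (E_1\ \ aE_1))&(0\le r,\ 2r+1\le\nu),\\ \varphi_3(r,a)=([\mathcal A_{2r},0^{(\nu-2r)}]+[-\tfrac12(1-za^2),0^{(\nu-1)}]\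 \ I\ \ (E_1\ \ aE_1))&(1\le r,\ 2r\le\nu),\\ \varphi_4(r)=([0,\mathcal A_{2r},0^{(\nu-1-2r)}]+[-\tfrac12\Delta,0^{(\nu-2)}]\ \ I\ \ (E_1\ \ E_2))&(0\le r,\ 2r+1\le\nu,\ 2\le\nu),\\ \varphi_5(r)=([Y,\mathcal A_{2r-2},0^{(\nu-1-2r)}]+[-\tfrac12\Delta,0^{(\nu-2)}]\ \ I\ \ (E_1\ \ E_2))&(1\le r,\ 2r+1\le\nu),\\ \varphi_6(r)=([-\tfrac12\Delta,\mathcal A_{2r},0^{(\nu-2r-2)}]\ \ I\ \ (E_1\ \ E_2))&(1\le r,\ 2r+2\le\nu),\\ \varphi_7(r,b)=([b\mathcal A_2-\tfrac12\Delta,\mathcal A_{2r-2},0^{(\nu-2r)}]\ \ I\ \ (E_1\ \ E_2))&(1\le r,\ 2r\le\nu),\\ \varphi_8(r)=([\mathcal K,\mathcal A_{2r-4},0^{(\nu-2r)}]+[-\tfrac12\Delta,0^{(\nu-2)}]\ \ I\ \ (E_1\ \ E_2))&(2\le r,\ 2r\le\nu). \end{array}$$ Write $g_m=|GL_m(\mathbb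 F)|$ and $s_{2m}=|Sp_{2m}(\mathbb F)|$ (so $g_0=s_0=1$). Then all these subspaces lie in $\Lambda$, their orbits under $G_{01}$ are nontrivial, and the lengths of these orbits are $$\begin{array}{rcl} |\overline{\varphi_1(r)}|&=&\dfrac{g_\nu}{s_{2r}\,g_{\nu-2r}\,q^{2r(\nu-2r)}},\\[8pt] |\overline{\varphi_2(r,a)}|&=&\dfrac{(q+1)\,g_\nu}{s_{2r}\,g_{\nu-2r-1}\cdot 2q^{(2r+1)(\nu-2r-1)}},\\[8pt] |\overline{\varphi_3(r,a)}|&=&\dfrac{(q+1)\,g_\nu}{s_{2r-2}\,g_{\nu-2r}\cdot 2q^{2r(\nu-2r)+2r-1}},\\[8pt] |\overline{\varphi_4(r)}|&=&\dfrac{(q+1)\,g_\nu}{s_{2r-2}\,g_{\nu-2r-1}\cdot 2q^{(2r+1)(\nu-2r)-2}}\quad(r\ge1),\qquad |\overline{\varphi_4(0)}|=\dfrac{g_\nu}{g_{\nu-2}\,q^{2(\nu-2)}},\\[8pt] |\overline{\varphi_5(r)}|&=&\dfrac{(q+1)\,g_\nu}{s_{2r-2}\,g_{\nu-2r-1}\cdot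 2q^{(2r+1)(\nu-2r)-2}},\\[8pt] |\overline{\varphi_6(r)}|&=&\dfrac{g_\nu}{s_{2r}\,g_{\nu-2r-2}\,q^{(2r+2)(\nu-2r-2)}},\\[8pt] |\overline{\varphi_7(r,b)}|&=&\dfrac{2\,g_\nu}{s_{2r-2}\,g_{\nu-2r}\,q^{2r(\nu-2r)}},\\[8pt] |\overline{\varphi_8(r)}|&=&\dfrac{g_\nu}{s_{2r-4}\,g_{\nu-2r}\,q^{2r(\nu-2r)+4r-5}}. \end{array}$$ -/

import Mathlib

namespace OrthSuborbit

section Space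

variable {F : Type*} [Field F]

/-- Index set of the coordinates of `F^(2ν+2)`, split into blocks of sizes `ν, ν, 2`. -/
abbrev Idx (ν : ℕ) : Type := Fin ν ⊕ Fin ν ⊕ Fin 2

/-- The definite `2 × 2` matrix `Δ = diag(1, -z)`. -/
def Δ (z : F) : Matrix (Fin 2) (Fin 2) F := Matrix.diagonal ![1, -z]

/-- The Gram matrix `S_{2ν+2,Δ}`, with block rows `(0 I 0)`, `(I 0 0)`, `(0 0 Δ)`. -/
def gram (ν : ℕ) (z : F) : Matrix (Idx ν) (Idx ν) F :=
  Matrix.fromBlocks 0 (Matrix.fromCols 1 0) (Matrix.fromRows 1 0)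
    (Matrix.fromBlocks 0 0 0 (Δ z))

/-- The orthogonal group `{T ∈ GL | T S Tᵗ = S}`. -/
def orthogonalGroup (ν : ℕ) (z : F) : Subgroup (GL (Idx ν) F) where
  carrier := {T | T.val * gram ν z * T.val.transpose = gram ν z}
  one_mem' := by simp
  mul_mem' := by
    intro A B hA hB
    simp only [Set.mem_ofPred_eq] at hA hB ⊢
    calc (A * B).val * gram ν z * (A * B).val.transpose
        = A.val * (B.val * gram ν z * B.val.transpose) * A.val.transpose := by
          simp [Matrix.transpose_mul, Matrix.mul_assoc]
      _ = gram ν z := by rw [hB, hA]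
  inv_mem' := by
    intro A hA
    simp only [Set.mem_ofPred_eq] at hA ⊢
    have h1 : A⁻¹.val * A.val = 1 := by rw [← Units.val_mul]; simp
    have h2 : A.val.transpose * A⁻¹.val.transpose = 1 := by
      rw [← Matrix.transpose_mul, h1, Matrix.transpose_one]
    calc A⁻¹.val * gram ν z * A⁻¹.val.transpose
        = A⁻¹.val * (A.val * gram ν z * A.val.transpose) * A⁻¹.val.transpose := by rw [hA]
      _ = (A⁻¹.val * A.val) * gram ν z * (A.val.transpose * A⁻¹.val.transpose) := by
          simp only [Matrix.mul_assoc]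
      _ = gram ν z := by rw [h1, h2, Matrix.one_mul, Matrix.mul_one]

/-- The right action of matrices on subspaces of the row space: `P ↦ P T`. -/
def act {ν : ℕ} (P : Submodule F (Idx ν → F)) (T : GL (Idx ν) F) : Submodule F (Idx ν → F) :=
  P.map (Matrix.vecMulLinear T.val)

theorem act_one {ν : ℕ} (P : Submodule F (Idx ν → F)) : act P 1 = P := by
  ext x
  simp [act]

theorem act_mul {ν : ℕ} (P : Submodule F (Idx ν → F)) (A B : GL (Idx ν) F) :
    act P (A * B) = act (act P A) B := by
  ext x
  simp [act, Matrix.vecMul_vecMul]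

/-- The stabilizer in `G` of a subspace `P`. -/
def stab {ν : ℕ} (G : Subgroup (GL (Idx ν) F)) (P : Submodule F (Idx ν → F)) :
    Subgroup (GL (Idx ν) F) where
  carrier := {T | T ∈ G ∧ act P T = P}
  one_mem' := ⟨G.one_mem, act_one P⟩
  mul_mem' := by
    rintro A B ⟨hA, hA'⟩ ⟨hB, hB'⟩
    exact ⟨G.mul_mem hA hB, by rw [act_mul, hA', hB']⟩
  inv_mem' := by
    rintro A ⟨hA, hA'⟩
    refine ⟨G.inv_mem hA, ?_⟩
    calc act P A⁻¹ = act (act P A) A⁻¹ := by rw [hA']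
      _ = P := by rw [← act_mul, mul_inv_cancel, act_one]

/-- `P` is totally isotropic: `P S Pᵗ = 0`. -/
def IsTotallyIsotropic {ν : ℕ} (z : F) (P : Submodule F (Idx ν → F)) : Prop :=
  ∀ x ∈ P, ∀ y ∈ P, x ⬝ᵥ (gram ν z).mulVec y = 0

/-- Vertices of the dual polar graph: the maximal totally isotropic subspaces. -/
abbrev Vertex (ν : ℕ) (z : F) : Type _ :=
  {P : Submodule F (Idx ν → F) // Maximal (IsTotallyIsotropic z) P}

/-- The dual polar graph: `P` and `Q` are adjacent when `dim (P ∩ Q) = ν - 1`. -/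
def dualPolarGraph (ν : ℕ) (z : F) : SimpleGraph (Vertex ν z) where
  Adj P Q := P ≠ Q ∧ Module.finrank F ↥(P.val ⊓ Q.val) + 1 = ν
  symm := ⟨fun P Q h => ⟨h.1.symm, by rw [inf_comm]; exact h.2⟩⟩
  loopless := ⟨fun _ h => h.1 rfl⟩

/-- The last subconstituent with respect to `P`: the vertices at distance `ν` from `P`. -/
def lastSubconstituent {ν : ℕ} (z : F) (P : Submodule F (Idx ν → F)) :
    Set (Submodule F (Idx ν → F)) :=
  {Q | ∃ (hP : Maximal (IsTotallyIsotropic z) P) (hQ : Maximal (IsTotallyIsotropic z) Q),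
    (dualPolarGraph ν z).dist ⟨P, hP⟩ ⟨Q, hQ⟩ = ν}

/-- `P₀ = (I 0 0)`, as a row space. -/
def P₀ (F : Type*) [Field F] (ν : ℕ) : Submodule F (Idx ν → F) :=
  Submodule.span F (Set.range (Matrix.fromCols (1 : Matrix (Fin ν) (Fin ν) F)
    (0 : Matrix (Fin ν) (Fin ν ⊕ Fin 2) F)))

/-- The row space of `(A I Z)`. -/
def pt {ν : ℕ} (A : Matrix (Fin ν) (Fin ν) F) (Z : Matrix (Fin ν) (Fin 2) F) :
    Submodule F (Idx ν → F) :=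
  Submodule.span F (Set.range (Matrix.fromCols A
    (Matrix.fromCols (1 : Matrix (Fin ν) (Fin ν) F) Z)))

/-- `P₁ = (0 I 0)`, as a row space. -/
def P₁ (F : Type*) [Field F] (ν : ℕ) : Submodule F (Idx ν → F) :=
  pt (0 : Matrix (Fin ν) (Fin ν) F) 0

/-- `Λ`, the last subconstituent with respect to `P₀`. -/
def Λ (ν : ℕ) (z : F) : Set (Submodule F (Idx ν → F)) := lastSubconstituent z (P₀ F ν)

/-- `G₀₁`, the stabilizer of `P₁` in the stabilizer `G₀` of `P₀` in the orthogonal group. -/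
def G₀₁ (ν : ℕ) (z : F) : Subgroup (GL (Idx ν) F) :=
  stab (stab (orthogonalGroup ν z) (P₀ F ν)) (P₁ F ν)

/-- The orbit of `Q` under `G₀₁`. -/
def suborbit {ν : ℕ} (z : F) (Q : Submodule F (Idx ν → F)) : Set (Submodule F (Idx ν → F)) :=
  {R | ∃ T ∈ G₀₁ ν z, R = act Q T}

/-- `Q` lies in `Λ`, its suborbit is not the trivial one `{P₁}`, and this suborbit
has length `ℓ`. -/
def HasSuborbitLength {ν : ℕ} (z : F) (Q : Submodule F (Idx ν → F)) (ℓ : ℚ) : Prop :=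
  Q ∈ Λ ν z ∧ suborbit z Q ≠ {P₁ F ν} ∧ ((suborbit z Q).ncard : ℚ) = ℓ

end Space

section Representatives

variable {F : Type*} [Field F]

/-- The `ν × n` matrix with a single entry `1`, in the row number `i` and the column number `j`
(counted from `0`); below `i` and `j` are always in range. -/
def E (F : Type*) [Field F] (ν n i j : ℕ) : Matrix (Fin ν) (Fin n) F :=
  Matrix.of fun k l => if k.val = i ∧ l.val = j then 1 else 0

/-- The elementary alternate matrix with `1` at `(i, j)` and `-1` at `(j, i)`. -/
def U (F : Type*) [Field F] (ν i j : ℕ) : Matrix (Fin ν) (Fin ν) F := E F ν ν i j - E F ν ν j i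

/-- The block diagonal matrix `[0^(s), 𝒜_{2r}, 0^(ν-s-2r)]`, where `𝒜_{2r}` has `r` diagonal
blocks with rows `(0 1)` and `(-1 0)`. -/
def alt (F : Type*) [Field F] (ν s r : ℕ) : Matrix (Fin ν) (Fin ν) F :=
  ∑ k ∈ Finset.range r, U F ν (s + 2 * k) (s + 2 * k + 1)

/-- `[-2⁻¹(1 - z a²), 0^(ν-1)]`. -/
def diagOne (ν : ℕ) (z a : F) : Matrix (Fin ν) (Fin ν) F :=
  (-(2⁻¹ * (1 - z * a ^ 2))) • E F ν ν 0 0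

/-- `[-2⁻¹ Δ, 0^(ν-2)]`. -/
def diagTwo (ν : ℕ) (z : F) : Matrix (Fin ν) (Fin ν) F :=
  (-(2⁻¹ : F)) • (E F ν ν 0 0 - z • E F ν ν 1 1)

/-- The `ν × 2` matrix `(E₁  aE₁)`. -/
def colsOne (ν : ℕ) (a : F) : Matrix (Fin ν) (Fin 2) F := E F ν 2 0 0 + a • E F ν 2 0 1

/-- The `ν × 2` matrix `(E₁  E₂)`. -/
def colsTwo (F : Type*) [Field F] (ν : ℕ) : Matrix (Fin ν) (Fin 2) F := E F ν 2 0 0 + E F ν 2 1 1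

/-- `([𝒜_{2r}, 0]  I  0)`. -/
def φ₁ (F : Type*) [Field F] (ν r : ℕ) : Submodule F (Idx ν → F) := pt (alt F ν 0 r) 0

/-- `([-2⁻¹(1 - z a²), 𝒜_{2r}, 0]  I  (E₁  aE₁))`. -/
def φ₂ (ν : ℕ) (z : F) (r : ℕ) (a : F) : Submodule F (Idx ν → F) :=
  pt (alt F ν 1 r + diagOne ν z a) (colsOne ν a)

/-- `([𝒜_{2r}, 0] + [-2⁻¹(1 - z a²), 0]  I  (E₁  aE₁))`. -/
def φ₃ (ν : ℕ) (z : F) (r : ℕ) (a : F) : Submodule F (Idx ν → F) :=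
  pt (alt F ν 0 r + diagOne ν z a) (colsOne ν a)

/-- `([0, 𝒜_{2r}, 0] + [-2⁻¹Δ, 0]  I  (E₁  E₂))`. -/
def φ₄ (ν : ℕ) (z : F) (r : ℕ) : Submodule F (Idx ν → F) :=
  pt (alt F ν 1 r + diagTwo ν z) (colsTwo F ν)

/-- `([Y, 𝒜_{2r-2}, 0] + [-2⁻¹Δ, 0]  I  (E₁  E₂))`, where `Y` has rows
`(0 0 1)`, `(0 0 1)`, `(-1 -1 0)`. -/
def φ₅ (ν : ℕ) (z : F) (r : ℕ) : Submodule F (Idx ν → F) :=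
  pt (U F ν 0 2 + U F ν 1 2 + alt F ν 3 (r - 1) + diagTwo ν z) (colsTwo F ν)

/-- `([-2⁻¹Δ, 𝒜_{2r}, 0]  I  (E₁  E₂))`. -/
def φ₆ (ν : ℕ) (z : F) (r : ℕ) : Submodule F (Idx ν → F) :=
  pt (alt F ν 2 r + diagTwo ν z) (colsTwo F ν)

/-- `([b𝒜₂ - 2⁻¹Δ, 𝒜_{2r-2}, 0]  I  (E₁  E₂))`. -/
def φ₇ (ν : ℕ) (z : F) (r : ℕ) (b : F) : Submodule F (Idx ν → F) :=
  pt (b • U F ν 0 1 + alt F ν 2 (r - 1) + diagTwo ν z) (colsTwo F ν)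

/-- `([𝒦, 𝒜_{2r-4}, 0] + [-2⁻¹Δ, 0]  I  (E₁  E₂))`, where `𝒦` has block rows
`(0 I)`, `(-I 0)` with `2 × 2` blocks. -/
def φ₈ (ν : ℕ) (z : F) (r : ℕ) : Submodule F (Idx ν → F) :=
  pt (U F ν 0 2 + U F ν 1 3 + alt F ν 4 (r - 2) + diagTwo ν z) (colsTwo F ν)

/-- `|GL_m(F)|`. -/
noncomputable def cardGL (F : Type*) [Field F] (m : ℕ) : ℕ := Nat.card (GL (Fin m) F)

/-- `|Sp_{2s}(F)|`. -/
noncomputable def cardSp (F : Type*) [Field F] (s : ℕ) : ℕ :=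
  Nat.card (Matrix.symplecticGroup (Fin s) F)

end Representatives

end OrthSuborbit

/-!
Every vertex at distance `ν` from `P₀` that is treated here has the form `(A  I  Z)` with
`A + Aᵗ + Z Δ Zᵗ = 0`, that is `A = K - ½ Z Δ Zᵗ` with `K` alternate (`altPt z K Z`). It meets `P₀`
trivially, and the dimensions of the intersections of adjacent vertices with `P₀` differ by at most
one, so the distance is at least `ν`. Replacing the rows of `(I  0  0)` one after the other by those
of `(A  I  Z)` gives a path of length `ν` (`pt_mem_Λ`).

The group `G₀₁` consists of the block matrices `diag(Mᵗ, M⁻¹, D)` with `M` invertible and `D` an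
isometry of `Δ` (`mem_G₀₁_iff`), and such an element carries the point of `(K, Z)` to the point of
`(M K Mᵗ, M Z D)`. By orbit–stabilizer a suborbit has length
`g_ν · |O(Δ)|` divided by the order of the stabilizer, where `|O(Δ)| = 2 (q + 1)`
(`ncard_orthDelta`). The stabilizer fibres over the subgroup of *admissible* `D`, those which some
`M` compensates, and each fibre is a coset of the group `isoSet K Z 1` of automorphisms of `K` that
fix the columns of `Z` (`card_stabilizer`).

For each representative a permutation of the coordinates (and, for `φ₅`, a transvection) brings `K`
into the form `A ⊕ 𝒜_{2r} ⊕ 0` with `A` of size at most `4` carrying all the columns of `Z`.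
The columns of `Z` act as marked functionals `x ↦ x Z`, which an automorphism has to fix, and the
count proceeds by splitting off orthogonal summands. A summand all of whose coordinates are marked
contributes, for each coordinate, the choice of a vector in the radical of the complement on which
the remaining functionals vanish (`ncard_isoSet_marked`). A hyperbolic plane with one marked
coordinate contributes the number of possible images of its two basis vectors
(`ncard_isoSet_hyp`). What remains is `𝒜_{2r} ⊕ 0` of size `2r + m`, with
`|Sp_{2r}| · q^{2rm} · |GL_m|` automorphisms (`ncard_isoSet_stdForm`).

The admissible `D` form all of `O(Δ)`, of order `2 (q + 1)`, for `φ₁`, `φ₆`, `φ₈` and `φ₄(0)`; the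
rotations, of order `q + 1`, for `φ₇`, where `D` has to preserve `b 𝒜₂`; and the isometries which
preserve a line, for `φ₂`, `φ₃`, `φ₅` and for `φ₄(r)` with `r ≥ 1`. As the plane is anisotropic,
there is a reflection in this line, and together with `-1` it generates the isometries preserving
it, a Klein four-group (`ncard_klein`).
-/

namespace OrthSuborbit

open Matrix

set_option linter.unusedSectionVars false


/-! ### The form and totally isotropic subspaces -/

section Geometry

variable {F : Type*} [Field F] {ν : ℕ}

theorem dotProduct_gram (z : F) (x y : Idx ν → F) :
    x ⬝ᵥ (gram ν z).mulVec y =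
      (∑ i, x (.inl i) * y (.inr (.inl i))) + (∑ i, x (.inr (.inl i)) * y (.inl i)) +
        (x (.inr (.inr 0)) * y (.inr (.inr 0)) - z * (x (.inr (.inr 1)) * y (.inr (.inr 1)))) := by
  have h1 : ∀ i : Fin ν, (gram ν z).mulVec y (.inl i) = y (.inr (.inl i)) := by
    intro i
    simp [gram, mulVec, dotProduct, Fintype.sum_sum_type, Matrix.one_apply]
  have h2 : ∀ i : Fin ν, (gram ν z).mulVec y (.inr (.inl i)) = y (.inl i) := by
    intro i
    simp [gram, mulVec, dotProduct, Fintype.sum_sum_type, Matrix.one_apply]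
  have h3 : (gram ν z).mulVec y (.inr (.inr 0)) = y (.inr (.inr 0)) := by
    simp [gram, mulVec, dotProduct, Fintype.sum_sum_type, Δ]
  have h4 : (gram ν z).mulVec y (.inr (.inr 1)) = -z * y (.inr (.inr 1)) := by
    simp [gram, mulVec, dotProduct, Fintype.sum_sum_type, Δ]
  rw [dotProduct, Fintype.sum_sum_type, Fintype.sum_sum_type, Fin.sum_univ_two]
  simp only [h1, h2, h3, h4]
  ring

/-- The norm form `s² - z t²` of the definite plane is anisotropic. -/
theorem anisotropic {z : F} (hz : ¬ IsSquare z) {s t : F} (h : s ^ 2 - z * t ^ 2 = 0) :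
    s = 0 ∧ t = 0 := by
  have ht : t = 0 := by
    by_contra ht
    exact hz ⟨s / t, by field_simp; linear_combination -h⟩
  subst ht
  exact ⟨by simpa using h, rfl⟩

/-- Embedding of `F^ν` as the first block of coordinates. -/
def firstBlock (F : Type*) [Field F] (ν : ℕ) : (Fin ν → F) →ₗ[F] (Idx ν → F) where
  toFun x := Sum.elim x 0
  map_add' x y := by ext (i | i) <;> simp
  map_smul' c x := by ext (i | i) <;> simp

/-- Projection onto the second block of coordinates. -/
def secondBlock (F : Type*) [Field F] (ν : ℕ) : (Idx ν → F) →ₗ[F] (Fin ν → F) :=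
  LinearMap.funLeft F F (fun i => .inr (.inl i))

theorem firstBlock_injective : Function.Injective (firstBlock F ν) := by
  intro x y h
  ext i
  simpa [firstBlock] using congrFun h (.inl i)

theorem P₀_eq_range : P₀ F ν = LinearMap.range (firstBlock F ν) := by
  have h := range_vecMulLinear (fromCols (1 : Matrix (Fin ν) (Fin ν) F)
    (0 : Matrix (Fin ν) (Fin ν ⊕ Fin 2) F))
  have h' : vecMulLinear (fromCols (1 : Matrix (Fin ν) (Fin ν) F)
    (0 : Matrix (Fin ν) (Fin ν ⊕ Fin 2) F)) = firstBlock F ν := by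
    ext x (i | i)
    · simp [firstBlock, Matrix.one_apply, Pi.single_apply, eq_comm]
    · simp [firstBlock]
  rw [← h', h]
  rfl

/-- A totally isotropic subspace has dimension at most `ν`. The vectors of `P` with vanishing
second block lie in the first block, because the plane is anisotropic, and they are orthogonal to
the second blocks of all vectors of `P`. -/
theorem finrank_le_of_isTotallyIsotropic {z : F} (hz : ¬ IsSquare z)
    {P : Submodule F (Idx ν → F)} (hP : IsTotallyIsotropic z P) : Module.finrank F P ≤ ν := by
  set N := P.comap (firstBlock F ν) with hN
  set R := P.map (secondBlock F ν) with hR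
  set f := (secondBlock F ν).domRestrict P with hf
  have h1 := LinearMap.finrank_range_add_finrank_ker f
  have hrange : LinearMap.range f = R := LinearMap.range_domRestrict _ _
  have hker : Module.finrank F (LinearMap.ker f) ≤ Module.finrank F N := by
    have hle : (LinearMap.ker f).map P.subtype ≤ N.map (firstBlock F ν) := by
      rintro _ ⟨⟨x, hx⟩, hxk, rfl⟩
      have hy : ∀ i, x (.inr (.inl i)) = 0 := fun i => congrFun hxk i
      have hq := hP x hx x hx
      rw [dotProduct_gram] at hq
      simp only [hy, mul_zero, zero_mul, Finset.sum_const_zero, zero_add] at hq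
      obtain ⟨h0, h1⟩ := anisotropic hz (s := x (.inr (.inr 0))) (t := x (.inr (.inr 1)))
        (by linear_combination hq)
      have hx' : firstBlock F ν (fun i => x (.inl i)) = x := by
        ext (i | i | i)
        · rfl
        · exact (hy i).symm
        · fin_cases i
          · exact h0.symm
          · exact h1.symm
      exact ⟨fun i => x (.inl i), by simpa [hN, hx'] using hx, hx'⟩
    have := Submodule.finrank_mono hle
    rwa [← (Submodule.equivMapOfInjective _ firstBlock_injective N).finrank_eq,
      ← (Submodule.equivMapOfInjective _ P.injective_subtype (LinearMap.ker f)).finrank_eq] at this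
  have horth : Module.finrank F R ≤ Module.finrank F N.dualAnnihilator := by
    have hle : R.map (dotProductEquiv F (Fin ν)).toLinearMap ≤ N.dualAnnihilator := by
      rintro _ ⟨_, ⟨x, hx, rfl⟩, rfl⟩
      rw [Submodule.mem_dualAnnihilator]
      intro w hw
      have := hP x hx _ hw
      rw [dotProduct_gram] at this
      simpa [firstBlock, secondBlock, dotProduct, LinearMap.funLeft] using this
    have := Submodule.finrank_mono hle
    rwa [LinearEquiv.finrank_map_eq] at this
  have h2 := Subspace.finrank_add_finrank_dualAnnihilator_eq N
  rw [hrange] at h1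
  simp only [Module.finrank_fintype_fun_eq_card, Fintype.card_fin] at h2
  omega

theorem maximal_of_finrank_eq {z : F} (hz : ¬ IsSquare z) {P : Submodule F (Idx ν → F)}
    (hP : IsTotallyIsotropic z P) (h : Module.finrank F P = ν) :
    Maximal (IsTotallyIsotropic z) P := by
  refine ⟨hP, fun Q hQ hPQ => ?_⟩
  have := Submodule.eq_of_le_of_finrank_le hPQ
    (by rw [h]; exact finrank_le_of_isTotallyIsotropic hz hQ)
  exact this.ge

theorem isTotallyIsotropic_span {ι : Type*} {z : F} {v : ι → Idx ν → F}
    (h : ∀ i j, v i ⬝ᵥ (gram ν z).mulVec (v j) = 0) :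
    IsTotallyIsotropic z (Submodule.span F (Set.range v)) := by
  intro x hx y hy
  induction hx using Submodule.span_induction with
  | mem x hx =>
    obtain ⟨i, rfl⟩ := hx
    induction hy using Submodule.span_induction with
    | mem y hy => obtain ⟨j, rfl⟩ := hy; exact h i j
    | zero => simp
    | add y y' _ _ h h' => rw [mulVec_add, dotProduct_add, h, h', add_zero]
    | smul c y _ h => rw [mulVec_smul, dotProduct_smul, h, smul_zero]
  | zero => simp
  | add x x' _ _ h h' => rw [add_dotProduct, h, h', add_zero]
  | smul c x _ h => rw [smul_dotProduct, h, smul_zero]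

/-! ### Distances in the dual polar graph -/

/-- Along an edge, the dimension of the intersection with a fixed subspace drops by at most one. -/
theorem finrank_inf_le_of_adj {z : F} (hz : ¬ IsSquare z) (W : Submodule F (Idx ν → F))
    {P Q : Vertex ν z} (h : (dualPolarGraph ν z).Adj P Q) :
    Module.finrank F ↥(W ⊓ P.val) ≤ Module.finrank F ↥(W ⊓ Q.val) + 1 := by
  have h1 := Submodule.finrank_sup_add_finrank_inf_eq (W ⊓ P.val) (P.val ⊓ Q.val)
  have h2 : Module.finrank F ↥((W ⊓ P.val) ⊔ (P.val ⊓ Q.val)) ≤ Module.finrank F P.val :=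
    Submodule.finrank_mono (sup_le inf_le_right inf_le_left)
  have h3 := finrank_le_of_isTotallyIsotropic hz P.2.1
  have h4 : Module.finrank F ↥((W ⊓ P.val) ⊓ (P.val ⊓ Q.val)) ≤ Module.finrank F ↥(W ⊓ Q.val) :=
    Submodule.finrank_mono
      (le_inf (inf_le_left.trans inf_le_left) (inf_le_right.trans inf_le_right))
  have h5 := h.2
  omega

theorem finrank_inf_le_of_walk {z : F} (hz : ¬ IsSquare z) (W : Submodule F (Idx ν → F))
    {P Q : Vertex ν z} (p : (dualPolarGraph ν z).Walk P Q) :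
    Module.finrank F ↥(W ⊓ P.val) ≤ Module.finrank F ↥(W ⊓ Q.val) + p.length := by
  induction p with
  | nil => simp
  | cons h p ih =>
    have := finrank_inf_le_of_adj hz W h
    rw [SimpleGraph.Walk.length_cons]
    omega

/-- Generators of the `n`-th subspace on a geodesic from `P₀` to `(X I Z)`: the first `n` rows of
`(X I Z)` followed by the rows of `P₀` with the remaining indices. -/
def geodesicRow (X : Matrix (Fin ν) (Fin ν) F) (Z : Matrix (Fin ν) (Fin 2) F) (n : ℕ) (j : Fin ν) :
    Idx ν → F :=
  if j.val < n then fromCols X (fromCols (1 : Matrix (Fin ν) (Fin ν) F) Z) j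
  else fromCols (1 : Matrix (Fin ν) (Fin ν) F) (0 : Matrix (Fin ν) (Fin ν ⊕ Fin 2) F) j

variable {X : Matrix (Fin ν) (Fin ν) F} {Z : Matrix (Fin ν) (Fin 2) F}

theorem linearIndependent_geodesicRow (n : ℕ) : LinearIndependent F (geodesicRow X Z n) := by
  rw [Fintype.linearIndependent_iff]
  intro c hc
  have hlow : ∀ j : Fin ν, j.val < n → c j = 0 := by
    intro j hj
    have := congrFun hc (.inr (.inl j))
    rw [Finset.sum_apply, Finset.sum_eq_single j] at this
    · simpa [geodesicRow, hj] using this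
    · intro b _ hb
      by_cases h : b.val < n <;> simp [geodesicRow, h, hb]
    · simp
  intro j
  by_cases hj : j.val < n
  · exact hlow j hj
  · have := congrFun hc (.inl j)
    rw [Finset.sum_apply, Finset.sum_eq_single j] at this
    · simpa [geodesicRow, hj] using this
    · intro b _ hb
      by_cases h : b.val < n
      · simp [hlow b h]
      · simp [geodesicRow, h, hb]
    · simp

theorem isTotallyIsotropic_geodesicRow {z : F} (hX : X + Xᵀ + Z * Δ z * Zᵀ = 0) (n : ℕ) :
    IsTotallyIsotropic z (Submodule.span F (Set.range (geodesicRow X Z n))) := by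
  refine isTotallyIsotropic_span fun i j => ?_
  have hij := congrFun (congrFun hX i) j
  simp [Matrix.mul_apply, Fin.sum_univ_two, Δ, Matrix.diagonal_apply] at hij
  -- mixed pairs `(i, j)` have `i ≠ j`, so the pairing of dual basis vectors vanishes
  by_cases hi : i.val < n <;> by_cases hj : j.val < n
  · rw [dotProduct_gram]
    simp [geodesicRow, hi, hj, Matrix.one_apply]
    linear_combination hij
  · have hne : i ≠ j := by rintro rfl; exact hj hi
    rw [dotProduct_gram]
    simp [geodesicRow, hi, hj, Matrix.one_apply, hne]
  · have hne : i ≠ j := by rintro rfl; exact hi hj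
    rw [dotProduct_gram]
    simp [geodesicRow, hi, hj, Matrix.one_apply, hne]
  · rw [dotProduct_gram]
    simp [geodesicRow, hi, hj, Matrix.one_apply]

theorem finrank_geodesicRow (n : ℕ) :
    Module.finrank F (Submodule.span F (Set.range (geodesicRow X Z n))) = ν := by
  rw [finrank_span_eq_card (linearIndependent_geodesicRow n), Fintype.card_fin]

/-- The vertices of a geodesic from `P₀` to `(X I Z)`. -/
def geodesicVertex {z : F} (hz : ¬ IsSquare z) (hX : X + Xᵀ + Z * Δ z * Zᵀ = 0) (n : ℕ) :
    Vertex ν z :=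
  ⟨Submodule.span F (Set.range (geodesicRow X Z n)),
    maximal_of_finrank_eq hz (isTotallyIsotropic_geodesicRow hX n) (finrank_geodesicRow n)⟩

theorem geodesicVertex_adj {z : F} (hz : ¬ IsSquare z) (hX : X + Xᵀ + Z * Δ z * Zᵀ = 0) {n : ℕ}
    (hn : n < ν) :
    (dualPolarGraph ν z).Adj (geodesicVertex hz hX n) (geodesicVertex hz hX (n + 1)) := by
  set A := Submodule.span F (Set.range (geodesicRow X Z n)) with hA
  set B := Submodule.span F (Set.range (geodesicRow X Z (n + 1))) with hB
  have hdA : Module.finrank F A = ν := finrank_geodesicRow n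
  -- the two subspaces differ: the old and the new generator of index `n` pair to `1`
  have hnot : ¬ A ≤ B := by
    intro h
    have h1 : geodesicRow X Z n ⟨n, hn⟩ ∈ B := h (Submodule.subset_span ⟨_, rfl⟩)
    have h2 : geodesicRow X Z (n + 1) ⟨n, hn⟩ ∈ B := Submodule.subset_span ⟨_, rfl⟩
    have := isTotallyIsotropic_geodesicRow hX (n + 1) _ h1 _ h2
    rw [dotProduct_gram] at this
    simp [geodesicRow, Matrix.one_apply] at this
  refine ⟨fun h => hnot (le_of_eq (congrArg Subtype.val h)), ?_⟩
  change Module.finrank F ↥(A ⊓ B) + 1 = ν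
  have hlt : Module.finrank F ↥(A ⊓ B) < Module.finrank F A :=
    Submodule.finrank_lt_finrank_of_lt (lt_of_le_of_ne inf_le_left fun h => hnot (inf_eq_left.mp h))
  set C := Submodule.span F (Set.range fun j : {j : Fin ν // j ≠ ⟨n, hn⟩} => geodesicRow X Z n j)
    with hC
  have hCle : C ≤ A ⊓ B := by
    rw [hC, Submodule.span_le]
    rintro _ ⟨⟨j, hj⟩, rfl⟩
    refine ⟨Submodule.subset_span ⟨j, rfl⟩, ?_⟩
    have : geodesicRow X Z n j = geodesicRow X Z (n + 1) j := by
      have hj' : j.val ≠ n := fun h => hj (Fin.ext h)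
      unfold geodesicRow
      by_cases h : j.val < n
      · rw [if_pos h, if_pos (by omega)]
      · rw [if_neg h, if_neg (by omega)]
    change geodesicRow X Z n j ∈ B
    rw [this]
    exact Submodule.subset_span ⟨j, rfl⟩
  have hCd : Module.finrank F C = ν - 1 := by
    have hli : LinearIndependent F
        (fun j : {j : Fin ν // j ≠ ⟨n, hn⟩} => geodesicRow X Z n j) :=
      (linearIndependent_geodesicRow n).comp _ Subtype.val_injective
    rw [hC, finrank_span_eq_card hli]
    simp [Fintype.card_subtype_compl]
  have := Submodule.finrank_mono hCle
  omega

/-- `(X I Z)` belongs to the last subconstituent as soon as it is totally isotropic. -/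
theorem pt_mem_Λ {z : F} (hz : ¬ IsSquare z) (hX : X + Xᵀ + Z * Δ z * Zᵀ = 0) :
    pt X Z ∈ Λ ν z := by
  have h0 : (geodesicVertex hz hX 0).val = P₀ F ν := by
    simp only [geodesicVertex, P₀]
    congr 2
  have h1 : (geodesicVertex hz hX ν).val = pt X Z := by
    simp only [geodesicVertex, pt]
    congr 2
    ext j : 1
    simp [geodesicRow]
  have hwalk : ∀ n ≤ ν, ∃ p : (dualPolarGraph ν z).Walk (geodesicVertex hz hX 0)
      (geodesicVertex hz hX n), p.length = n := by
    intro n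
    induction n with
    | zero => exact fun _ => ⟨.nil, rfl⟩
    | succ n ih =>
      intro hn
      obtain ⟨p, hp⟩ := ih (by omega)
      exact ⟨p.concat (geodesicVertex_adj hz hX hn), by simp [hp]⟩
  obtain ⟨p, hp⟩ := hwalk ν le_rfl
  refine ⟨h0 ▸ (geodesicVertex hz hX 0).2, h1 ▸ (geodesicVertex hz hX ν).2, ?_⟩
  have e0 : (⟨P₀ F ν, h0 ▸ (geodesicVertex hz hX 0).2⟩ : Vertex ν z) = geodesicVertex hz hX 0 :=
    Subtype.ext h0.symm
  have e1 : (⟨pt X Z, h1 ▸ (geodesicVertex hz hX ν).2⟩ : Vertex ν z) = geodesicVertex hz hX ν :=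
    Subtype.ext h1.symm
  rw [e0, e1]
  refine le_antisymm ((SimpleGraph.dist_le p).trans hp.le) ?_
  obtain ⟨w, hw⟩ := p.reachable.exists_walk_length_eq_dist
  rw [← hw]
  have hle := finrank_inf_le_of_walk hz (P₀ F ν) w
  have hbot : P₀ F ν ⊓ pt X Z = ⊥ := by
    rw [eq_bot_iff]
    rintro x ⟨hx0, hx1⟩
    rw [SetLike.mem_coe, P₀_eq_range] at hx0
    obtain ⟨y, rfl⟩ := hx0
    have hpt : pt X Z = LinearMap.range (fromCols X (fromCols 1 Z)).vecMulLinear :=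
      (range_vecMulLinear _).symm
    rw [SetLike.mem_coe, hpt] at hx1
    obtain ⟨c, hc⟩ := hx1
    have hc0 : c = 0 := by
      ext i
      simpa [firstBlock] using congrFun hc (.inr (.inl i))
    rw [← hc, hc0]
    simp
  rw [h1, hbot, h0, inf_idem, finrank_bot, ← h0, zero_add] at hle
  exact (finrank_geodesicRow 0).symm.le.trans hle

end Geometry


/-! ### The stabilizer `G₀₁` and its orbits -/

section Orbits

variable {F : Type*} [Field F] {ν : ℕ}

theorem pt_eq_range (A : Matrix (Fin ν) (Fin ν) F) (Z : Matrix (Fin ν) (Fin 2) F) :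
    pt A Z =
      LinearMap.range (fromCols A (fromCols (1 : Matrix (Fin ν) (Fin ν) F) Z)).vecMulLinear :=
  (range_vecMulLinear _).symm

theorem P₀_eq_range_vecMulLinear :
    P₀ F ν = LinearMap.range (fromCols (1 : Matrix (Fin ν) (Fin ν) F)
      (0 : Matrix (Fin ν) (Fin ν ⊕ Fin 2) F)).vecMulLinear :=
  (range_vecMulLinear _).symm

theorem pt_injective {A A' : Matrix (Fin ν) (Fin ν) F} {Z Z' : Matrix (Fin ν) (Fin 2) F}
    (h : pt A Z = pt A' Z') : A = A' ∧ Z = Z' := by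
  have key : ∀ i, fromCols A' (fromCols (1 : Matrix (Fin ν) (Fin ν) F) Z') i =
      fromCols A (fromCols 1 Z) i := by
    intro i
    have hi : fromCols A' (fromCols (1 : Matrix (Fin ν) (Fin ν) F) Z') i ∈ pt A Z :=
      h ▸ Submodule.subset_span ⟨i, rfl⟩
    rw [pt_eq_range] at hi
    obtain ⟨c, hc⟩ := hi
    have hci : c = Pi.single i 1 := by
      ext j
      simpa [Matrix.one_apply, Pi.single_apply, eq_comm] using congrFun hc (.inr (.inl j))
    rw [← hc, hci]
    exact (Matrix.single_one_vecMul i (fromCols A (fromCols (1 : Matrix (Fin ν) (Fin ν) F) Z)))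
  refine ⟨?_, ?_⟩
  · ext i j
    simpa using (congrFun (key i) (.inl j)).symm
  · ext i j
    simpa using (congrFun (key i) (.inr (.inr j))).symm

/-- The orthogonal matrices of `Δ`, acting on the definite plane. -/
def orthDelta (z : F) : Set (Matrix (Fin 2) (Fin 2) F) := {D | D * Δ z * Dᵀ = Δ z}

theorem isUnit_det_of_mem_orthDelta {z : F} (hz0 : z ≠ 0) {D : Matrix (Fin 2) (Fin 2) F}
    (hD : D ∈ orthDelta z) : IsUnit D.det := by
  have h := congrArg Matrix.det hD
  have hΔ : (Δ z).det ≠ 0 := by simp [Δ, hz0]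
  rw [det_mul, det_mul] at h
  refine isUnit_iff_ne_zero.mpr fun h0 => hΔ ?_
  rw [← h, h0, zero_mul, zero_mul]

/-- The block diagonal matrix with blocks `Mᵗ, M⁻¹, D`: the general form of an element of
`G₀₁`. -/
noncomputable def blockMat (M : Matrix (Fin ν) (Fin ν) F) (D : Matrix (Fin 2) (Fin 2) F) :
    Matrix (Idx ν) (Idx ν) F :=
  fromBlocks Mᵀ 0 0 (fromBlocks M⁻¹ 0 0 D)

theorem blockMat_isUnit {z : F} (hz0 : z ≠ 0) {M : Matrix (Fin ν) (Fin ν) F} (hM : IsUnit M.det)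
    {D : Matrix (Fin 2) (Fin 2) F} (hD : D ∈ orthDelta z) : IsUnit (blockMat M D) := by
  rw [Matrix.isUnit_iff_isUnit_det, blockMat, det_fromBlocks_zero₂₁, det_fromBlocks_zero₂₁,
    det_transpose]
  exact hM.mul (((Matrix.isUnit_nonsing_inv_det_iff).mpr hM).mul
    (isUnit_det_of_mem_orthDelta hz0 hD))

theorem blockMat_preserves_gram {z : F} {M : Matrix (Fin ν) (Fin ν) F} (hM : IsUnit M.det)
    {D : Matrix (Fin 2) (Fin 2) F} (hD : D ∈ orthDelta z) :
    blockMat M D * gram ν z * (blockMat M D)ᵀ = gram ν z := by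
  have hD' : D * Δ z * Dᵀ = Δ z := hD
  have h1 : Mᵀ * M⁻¹ᵀ = 1 := by rw [← transpose_mul, nonsing_inv_mul _ hM, transpose_one]
  rw [blockMat, gram, fromBlocks_transpose, fromBlocks_multiply, fromBlocks_multiply]
  congr 1
  · simp
  · simp [fromBlocks_transpose, mul_fromCols, fromCols_mul_fromBlocks, h1]
  · simp [fromBlocks_mul_fromRows, fromRows_mul, nonsing_inv_mul _ hM]
  · simp [fromBlocks_transpose, fromBlocks_multiply, hD']

theorem map_range_vecMulLinear_of_mul_eq {T : Matrix (Idx ν) (Idx ν) F}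
    {R : Matrix (Fin ν) (Idx ν) F} {N : Matrix (Fin ν) (Fin ν) F} (hN : IsUnit N.det)
    (h : R * T = N * R) :
    (LinearMap.range R.vecMulLinear).map (vecMulLinear T) = LinearMap.range R.vecMulLinear := by
  ext x
  constructor
  · rintro ⟨_, ⟨c, rfl⟩, rfl⟩
    exact ⟨c ᵥ* N, by simp [vecMul_vecMul, h]⟩
  · rintro ⟨c, rfl⟩
    refine ⟨_, ⟨c ᵥ* N⁻¹, rfl⟩, ?_⟩
    simp [vecMul_vecMul, h, nonsing_inv_mul_cancel_left _ _ hN, Matrix.mul_assoc]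

theorem act_P₀_blockMat {T : GL (Idx ν) F} {M : Matrix (Fin ν) (Fin ν) F} (hM : IsUnit M.det)
    {D : Matrix (Fin 2) (Fin 2) F} (hT : T.val = blockMat M D) : act (P₀ F ν) T = P₀ F ν := by
  rw [act, hT, P₀_eq_range_vecMulLinear]
  refine map_range_vecMulLinear_of_mul_eq (N := Mᵀ) (by rwa [det_transpose]) ?_
  ext i (j | j) <;> simp [blockMat, Matrix.mul_apply, Matrix.one_apply]

theorem act_pt_blockMat {T : GL (Idx ν) F} {M : Matrix (Fin ν) (Fin ν) F} (hM : IsUnit M.det)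
    {D : Matrix (Fin 2) (Fin 2) F} (hT : T.val = blockMat M D) (X : Matrix (Fin ν) (Fin ν) F)
    (Z : Matrix (Fin ν) (Fin 2) F) : act (pt X Z) T = pt (M * X * Mᵀ) (M * Z * D) := by
  have h : (fromCols X (fromCols 1 Z) : Matrix (Fin ν) (Idx ν) F) * blockMat M D =
      M⁻¹ * (fromCols (M * X * Mᵀ) (fromCols 1 (M * Z * D)) : Matrix (Fin ν) (Idx ν) F) := by
    rw [mul_fromCols, mul_fromCols, blockMat, fromCols_mul_fromBlocks, fromCols_mul_fromBlocks]
    simp [Matrix.mul_assoc, nonsing_inv_mul_cancel_left _ _ hM]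
  rw [act, hT, pt_eq_range, pt_eq_range]
  ext x
  constructor
  · rintro ⟨_, ⟨c, rfl⟩, rfl⟩
    refine ⟨c ᵥ* M⁻¹, ?_⟩
    change (c ᵥ* M⁻¹) ᵥ* _ = (c ᵥ* _) ᵥ* blockMat M D
    rw [vecMul_vecMul, vecMul_vecMul, ← h]
  · rintro ⟨c, rfl⟩
    refine ⟨_, ⟨c ᵥ* M, rfl⟩, ?_⟩
    change ((c ᵥ* M) ᵥ* (_ : Matrix (Fin ν) (Idx ν) F)) ᵥ* blockMat M D = c ᵥ* _
    rw [vecMul_vecMul, vecMul_vecMul, h, mul_nonsing_inv_cancel_left _ _ hM]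

theorem mem_G₀₁_iff {z : F} (T : GL (Idx ν) F) :
    T ∈ G₀₁ ν z ↔ ∃ M D, IsUnit M.det ∧ D ∈ orthDelta z ∧ T.val = blockMat M D := by
  constructor
  · rintro ⟨⟨hO, h0⟩, h1⟩
    replace hO : T.val * gram ν z * T.valᵀ = gram ν z := hO
    have hT0 : ∀ i j, T.val (.inl i) (.inr j) = 0 := by
      intro i j
      have hi : T.val.row (.inl i) ∈ P₀ F ν := by
        rw [← h0]
        refine ⟨_, Submodule.subset_span ⟨i, rfl⟩, ?_⟩
        ext k
        simp [vecMul, dotProduct, Fintype.sum_sum_type, Matrix.one_apply]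
      rw [P₀_eq_range] at hi
      obtain ⟨y, hy⟩ := hi
      simpa [firstBlock] using (congrFun hy (.inr j)).symm
    have hrow : ∀ i, T.val.row (.inr (.inl i)) ∈ P₁ F ν := by
      intro i
      rw [← h1]
      refine ⟨_, Submodule.subset_span ⟨i, rfl⟩, ?_⟩
      ext k
      simp [vecMul, dotProduct, Fintype.sum_sum_type, Matrix.one_apply]
    have hT1 : ∀ i j, T.val (.inr (.inl i)) (.inl j) = 0 := by
      intro i j
      have hi := hrow i
      rw [P₁, pt_eq_range] at hi
      obtain ⟨y, hy⟩ := hi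
      simpa using (congrFun hy (.inl j)).symm
    have hT2 : ∀ i j, T.val (.inr (.inl i)) (.inr (.inr j)) = 0 := by
      intro i j
      have hi := hrow i
      rw [P₁, pt_eq_range] at hi
      obtain ⟨y, hy⟩ := hi
      simpa using (congrFun hy (.inr (.inr j))).symm
    have hdec : T.val = fromBlocks T.val.toBlocks₁₁ 0 (fromRows 0 T.val.toBlocks₂₁.toRows₂)
        (fromBlocks T.val.toBlocks₂₂.toBlocks₁₁ 0 T.val.toBlocks₂₂.toBlocks₂₁
          T.val.toBlocks₂₂.toBlocks₂₂) := by
      ext (i | i | i) (j | j | j) <;>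
        simp [hT0, hT1, hT2, toBlocks₁₁, toBlocks₂₁, toBlocks₂₂, toRows₂]
    set A := T.val.toBlocks₁₁
    set B := T.val.toBlocks₂₂.toBlocks₁₁
    set D := T.val.toBlocks₂₂.toBlocks₂₂
    set C := T.val.toBlocks₂₁.toRows₂
    set C' := T.val.toBlocks₂₂.toBlocks₂₁
    have ent := hO
    rw [hdec] at ent
    have hAB : A * Bᵀ = 1 := by
      ext i j
      have := congrFun (congrFun ent (.inl i)) (.inr (.inl j))
      simpa [gram, fromBlocks_transpose, Matrix.mul_apply, Fintype.sum_sum_type,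
        Matrix.one_apply] using this
    have hAC : A * C'ᵀ = 0 := by
      ext i j
      have := congrFun (congrFun ent (.inl i)) (.inr (.inr j))
      simpa [gram, fromBlocks_transpose, Matrix.mul_apply, Fintype.sum_sum_type,
        Matrix.one_apply] using this
    have hBC : B * Cᵀ = 0 := by
      ext i j
      have := congrFun (congrFun ent (.inr (.inl i))) (.inr (.inr j))
      simpa [gram, fromBlocks_transpose, Matrix.mul_apply, Fintype.sum_sum_type,
        Matrix.one_apply] using this
    have hA : IsUnit A.det := Matrix.isUnit_det_of_right_inverse hAB
    have hBA : B * Aᵀ = 1 := by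
      rw [← transpose_transpose B, ← transpose_mul, hAB, transpose_one]
    have hBu : IsUnit B.det := Matrix.isUnit_det_of_right_inverse hBA
    have hC' : C' = 0 := by
      have h : C'ᵀ = 0 := by rw [← nonsing_inv_mul_cancel_left A C'ᵀ hA, hAC, Matrix.mul_zero]
      rw [← transpose_transpose C', h, transpose_zero]
    have hC : C = 0 := by
      have h : Cᵀ = 0 := by rw [← nonsing_inv_mul_cancel_left B Cᵀ hBu, hBC, Matrix.mul_zero]
      rw [← transpose_transpose C, h, transpose_zero]
    rw [hC, hC'] at hdec ent
    have hD : D * Δ z * Dᵀ = Δ z := by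
      ext i j
      have := congrFun (congrFun ent (.inr (.inr i))) (.inr (.inr j))
      simpa [gram, fromBlocks_transpose, Matrix.mul_apply, Fintype.sum_sum_type,
        Matrix.one_apply] using this
    refine ⟨Aᵀ, D, by rwa [det_transpose], hD, ?_⟩
    rw [hdec, blockMat, transpose_transpose, Matrix.inv_eq_left_inv hBA]
    congr 1
    ext (i | i) j <;> rfl
  · rintro ⟨M, D, hM, hD, hT⟩
    refine ⟨⟨?_, act_P₀_blockMat hM hT⟩, ?_⟩
    · change T.val * gram ν z * T.valᵀ = gram ν z
      rw [hT]
      exact blockMat_preserves_gram hM hD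
    · rw [P₁, act_pt_blockMat hM hT]
      simp

theorem blockMat_injective {M M' : Matrix (Fin ν) (Fin ν) F} {D D' : Matrix (Fin 2) (Fin 2) F}
    (h : blockMat M D = blockMat M' D') : M = M' ∧ D = D' := by
  obtain ⟨h1, -, -, h2⟩ := fromBlocks_inj.mp h
  exact ⟨transpose_injective h1, (fromBlocks_inj.mp h2).2.2.2⟩

/-- The invertible matrices `M` which, paired with `D`, fix the form `K` and the columns `Z`. -/
def isoSet {ι κ : Type*} [Fintype ι] [DecidableEq ι] [Fintype κ] (K : Matrix ι ι F)
    (Z : Matrix ι κ F) (D : Matrix κ κ F) : Set (Matrix ι ι F) :=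
  {M | IsUnit M.det ∧ M * K * Mᵀ = K ∧ M * Z * D = Z}

/-- The elements of `O(Δ)` that occur in the stabilizer of the pair `(K, Z)`. -/
def admissible {ι : Type*} [Fintype ι] [DecidableEq ι] (z : F) (K : Matrix ι ι F)
    (Z : Matrix ι (Fin 2) F) : Set (Matrix (Fin 2) (Fin 2) F) :=
  {D | D ∈ orthDelta z ∧ (isoSet K Z D).Nonempty}

/-- The point of the last subconstituent with alternating part `K` and columns `Z`. -/
def altPt (z : F) (K : Matrix (Fin ν) (Fin ν) F) (Z : Matrix (Fin ν) (Fin 2) F) :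
    Submodule F (Idx ν → F) :=
  pt (K - (2⁻¹ : F) • (Z * Δ z * Zᵀ)) Z

theorem act_altPt_eq_iff {z : F} {T : GL (Idx ν) F} {M : Matrix (Fin ν) (Fin ν) F}
    (hM : IsUnit M.det) {D : Matrix (Fin 2) (Fin 2) F} (hD : D ∈ orthDelta z)
    (hT : T.val = blockMat M D) (K : Matrix (Fin ν) (Fin ν) F) (Z : Matrix (Fin ν) (Fin 2) F) :
    act (altPt z K Z) T = altPt z K Z ↔ M ∈ isoSet K Z D := by
  have hD' : D * Δ z * Dᵀ = Δ z := hD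
  have key : M * Z * D = Z → M * (Z * Δ z * Zᵀ) * Mᵀ = Z * Δ z * Zᵀ := by
    intro h
    calc M * (Z * Δ z * Zᵀ) * Mᵀ = (M * Z) * (D * Δ z * Dᵀ) * (M * Z)ᵀ := by
          rw [hD', transpose_mul]; simp only [Matrix.mul_assoc]
      _ = (M * Z * D) * Δ z * (M * Z * D)ᵀ := by
          rw [transpose_mul (M * Z) D]; simp only [Matrix.mul_assoc]
      _ = _ := by rw [h]
  rw [altPt, act_pt_blockMat hM hT, Matrix.mul_sub, Matrix.sub_mul, Matrix.mul_smul,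
    Matrix.smul_mul]
  constructor
  · intro h
    obtain ⟨h1, h2⟩ := pt_injective h
    rw [key h2] at h1
    exact ⟨hM, sub_left_injective h1, h2⟩
  · rintro ⟨-, h1, h2⟩
    rw [key h2, h1, h2]

theorem ncard_isoSet_eq {ι κ : Type*} [Fintype ι] [DecidableEq ι] [Fintype κ] [DecidableEq κ]
    {K : Matrix ι ι F} {Z : Matrix ι κ F} {D : Matrix κ κ F} (hD : IsUnit D.det)
    (h : (isoSet K Z D).Nonempty) :
    (isoSet K Z D).ncard = (isoSet K Z 1).ncard := by
  obtain ⟨M₀, hu, hK, hZ⟩ := h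
  symm
  refine Set.ncard_congr (fun M _ => M₀ * M) ?_ ?_ ?_
  · rintro M ⟨h1, h2, h3⟩
    rw [Matrix.mul_one] at h3
    refine ⟨by rw [det_mul]; exact hu.mul h1, ?_, ?_⟩
    · calc M₀ * M * K * (M₀ * M)ᵀ = M₀ * (M * K * Mᵀ) * M₀ᵀ := by
            rw [transpose_mul]; simp only [Matrix.mul_assoc]
        _ = K := by rw [h2, hK]
    · rw [Matrix.mul_assoc M₀, h3, hZ]
  · intro M M' _ _ h
    rw [← nonsing_inv_mul_cancel_left M₀ M hu, h, nonsing_inv_mul_cancel_left M₀ M' hu]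
  · rintro M ⟨h1, h2, h3⟩
    have hcancel : M₀ * (M₀⁻¹ * M) = M := mul_nonsing_inv_cancel_left M₀ M hu
    refine ⟨M₀⁻¹ * M, ⟨?_, ?_, ?_⟩, hcancel⟩
    · rw [det_mul]
      exact ((isUnit_nonsing_inv_det_iff).mpr hu).mul h1
    · have e : M₀⁻¹ * K * M₀⁻¹ᵀ = K := by
        nth_rewrite 1 [← hK]
        calc M₀⁻¹ * (M₀ * K * M₀ᵀ) * M₀⁻¹ᵀ = (M₀⁻¹ * M₀) * K * (M₀⁻¹ * M₀)ᵀ := by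
              rw [transpose_mul]; simp only [Matrix.mul_assoc]
          _ = K := by rw [nonsing_inv_mul _ hu]; simp
      calc M₀⁻¹ * M * K * (M₀⁻¹ * M)ᵀ = M₀⁻¹ * (M * K * Mᵀ) * M₀⁻¹ᵀ := by
            rw [transpose_mul]; simp only [Matrix.mul_assoc]
        _ = K := by rw [h2, e]
    · have e : M * Z = M₀ * Z := by
        rw [← mul_nonsing_inv_cancel_right D (M * Z) hD, h3, ← hZ,
          mul_nonsing_inv_cancel_right D (M₀ * Z) hD, hZ]
      rw [Matrix.mul_one, Matrix.mul_assoc, e, nonsing_inv_mul_cancel_left _ _ hu]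

/-- The elements of `G₀₁` fixing a point are counted by the admissible `D` and, for each of them,
by the automorphisms of the pair `(K, Z)`. -/
theorem card_stabilizer [Finite F] {z : F} (hz0 : z ≠ 0) (K : Matrix (Fin ν) (Fin ν) F)
    (Z : Matrix (Fin ν) (Fin 2) F) :
    Nat.card {T : GL (Idx ν) F // T ∈ G₀₁ ν z ∧ act (altPt z K Z) T = altPt z K Z} =
      (admissible z K Z).ncard * (isoSet K Z 1).ncard := by
  have e1 : Nat.card (Σ D : admissible z K Z, isoSet K Z D.1) =
      (admissible z K Z).ncard * (isoSet K Z 1).ncard := by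
    have : Fintype (admissible z K Z) := Fintype.ofFinite _
    rw [Nat.card_sigma]
    simp only [Nat.card_coe_set_eq]
    rw [Finset.sum_congr rfl fun D _ =>
      ncard_isoSet_eq (isUnit_det_of_mem_orthDelta hz0 D.2.1) D.2.2, Finset.sum_const,
      Finset.card_univ, smul_eq_mul, ← Nat.card_eq_fintype_card, Nat.card_coe_set_eq]
  rw [← e1]
  symm
  let u : ∀ p : (Σ D : admissible z K Z, isoSet K Z D.1), GL (Idx ν) F := fun p =>
    (blockMat_isUnit hz0 p.2.2.1 p.1.2.1).unit
  refine Nat.card_congr (Equiv.ofBijective (fun p => ⟨u p, ?_, ?_⟩) ⟨?_, ?_⟩)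
  · exact (mem_G₀₁_iff _).mpr ⟨_, _, p.2.2.1, p.1.2.1, rfl⟩
  · exact (act_altPt_eq_iff (T := u p) p.2.2.1 p.1.2.1 rfl K Z).mpr p.2.2
  · rintro ⟨⟨D, hD⟩, ⟨M, hM⟩⟩ ⟨⟨D', hD'⟩, ⟨M', hM'⟩⟩ h
    have h' : blockMat M D = blockMat M' D' := congrArg (fun T => T.1.val) h
    obtain ⟨rfl, rfl⟩ := blockMat_injective h'
    rfl
  · rintro ⟨T, hT, hfix⟩
    obtain ⟨M, D, hM, hD, hTM⟩ := (mem_G₀₁_iff T).mp hT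
    have hmem := (act_altPt_eq_iff hM hD hTM K Z).mp hfix
    exact ⟨⟨⟨D, hD, ⟨M, hmem⟩⟩, ⟨M, hmem⟩⟩, Subtype.ext (Units.ext hTM.symm)⟩

/-- The right action of `G₀₁` on subspaces, as a left action of the inverses. -/
noncomputable abbrev suborbitAction (ν : ℕ) (z : F) :
    MulAction (G₀₁ ν z) (Submodule F (Idx ν → F)) where
  smul T Q := act Q (T⁻¹ : GL (Idx ν) F)
  one_smul Q := by
    change act Q ((1 : GL (Idx ν) F)⁻¹) = Q
    rw [inv_one, act_one]
  mul_smul S T Q := by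
    change act Q ((S * T : GL (Idx ν) F)⁻¹) = act (act Q (T⁻¹ : GL (Idx ν) F)) (S⁻¹ : GL (Idx ν) F)
    rw [_root_.mul_inv_rev, act_mul]

theorem card_suborbit (z : F) (Q : Submodule F (Idx ν → F)) :
    Nat.card {T : GL (Idx ν) F // T ∈ G₀₁ ν z ∧ act Q T = Q} * (suborbit z Q).ncard =
      Nat.card (G₀₁ ν z) := by
  let := suborbitAction ν z
  have horb : MulAction.orbit (G₀₁ ν z) Q = suborbit z Q := by
    ext R
    constructor
    · rintro ⟨T, rfl⟩
      exact ⟨_, (T⁻¹).2, rfl⟩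
    · rintro ⟨T, hT, rfl⟩
      refine ⟨⟨T, hT⟩⁻¹, ?_⟩
      change act Q (T⁻¹⁻¹) = act Q T
      rw [inv_inv]
  have hst : Nat.card (MulAction.stabilizer (G₀₁ ν z) Q) =
      Nat.card {T : GL (Idx ν) F // T ∈ G₀₁ ν z ∧ act Q T = Q} := by
    refine Nat.card_congr
      { toFun := fun T => ⟨(T.1⁻¹ : G₀₁ ν z), (T.1⁻¹).2, T.2⟩
        invFun := fun T => ⟨⟨T.1, T.2.1⟩⁻¹, ?_⟩
        left_inv := fun T => ?_
        right_inv := fun T => ?_ }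
    · change act Q (T.1⁻¹⁻¹) = Q
      rw [inv_inv, T.2.2]
    · ext1
      exact inv_inv _
    · ext1
      exact inv_inv _
  rw [← hst, ← horb, ← MulAction.index_stabilizer, Subgroup.card_mul_index]

theorem ncard_isUnit_det (ν : ℕ) :
    {M : Matrix (Fin ν) (Fin ν) F | IsUnit M.det}.ncard = cardGL F ν := by
  rw [cardGL, ← Nat.card_coe_set_eq]
  exact Nat.card_congr
    { toFun := fun M => Matrix.nonsingInvUnit M.1 M.2
      invFun := fun M => ⟨M.val, (Matrix.isUnit_iff_isUnit_det _).mp M.isUnit⟩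
      left_inv := fun M => rfl
      right_inv := fun M => Units.ext rfl }

theorem P₁_eq_altPt (z : F) : P₁ F ν = altPt z 0 0 := by
  simp [P₁, altPt]

theorem card_G₀₁ [Finite F] {z : F} (hz0 : z ≠ 0) :
    Nat.card (G₀₁ ν z) = (orthDelta z).ncard * cardGL F ν := by
  have h := card_stabilizer hz0 (0 : Matrix (Fin ν) (Fin ν) F) 0
  have h1 : admissible z (0 : Matrix (Fin ν) (Fin ν) F) 0 = orthDelta z := by
    ext D
    exact ⟨fun h => h.1, fun h => ⟨h, 1, by simp [isoSet]⟩⟩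
  have h2 : isoSet (0 : Matrix (Fin ν) (Fin ν) F) (0 : Matrix (Fin ν) (Fin 2) F) 1 =
      {M | IsUnit M.det} := by
    ext M
    simp [isoSet]
  rw [h1, h2, ncard_isUnit_det] at h
  rw [← h]
  refine Nat.card_congr (Equiv.subtypeEquivRight fun T => ?_)
  rw [← P₁_eq_altPt]
  exact ⟨fun h => ⟨h, h.2⟩, fun h => h.1⟩

/-- The length of the suborbit of a nontrivial point, from the order of its stabilizer. -/
theorem hasSuborbitLength_altPt [Finite F] {z : F} (hz : ¬ IsSquare z) (h2 : (2 : F) ≠ 0)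
    {K : Matrix (Fin ν) (Fin ν) F} {Z : Matrix (Fin ν) (Fin 2) F} (hK : Kᵀ = -K)
    (hne : K ≠ 0 ∨ Z ≠ 0) {n m : ℕ} (hn : (admissible z K Z).ncard = n)
    (hm : (isoSet K Z 1).ncard = m) :
    HasSuborbitLength z (altPt z K Z)
      (((orthDelta z).ncard * cardGL F ν : ℚ) / (n * m)) := by
  have hz0 : z ≠ 0 := by rintro rfl; exact hz IsSquare.zero
  refine ⟨pt_mem_Λ hz ?_, ?_, ?_⟩
  · have hΔ : (Δ z)ᵀ = Δ z := by simp [Δ]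
    have hs : (Z * Δ z * Zᵀ)ᵀ = Z * Δ z * Zᵀ := by
      simp [transpose_mul, Matrix.mul_assoc, hΔ]
    have h22 : (2⁻¹ : F) + 2⁻¹ = 1 := by field_simp; norm_num
    have hh : Z * Δ z * Zᵀ = (2⁻¹ : F) • (Z * Δ z * Zᵀ) + (2⁻¹ : F) • (Z * Δ z * Zᵀ) := by
      rw [← add_smul, h22, one_smul]
    rw [transpose_sub, transpose_smul, hs, hK]
    nth_rewrite 3 [hh]
    abel
  · intro h
    have hmem : altPt z K Z ∈ suborbit z (altPt z K Z) := ⟨1, one_mem _, (act_one _).symm⟩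
    rw [h, Set.mem_singleton_iff, P₁_eq_altPt z] at hmem
    obtain ⟨hX, rfl⟩ := pt_injective hmem
    rcases hne with h | h
    · exact h (by simpa using hX)
    · exact h rfl
  · have h := card_suborbit z (altPt z K Z)
    rw [card_stabilizer hz0, card_G₀₁ hz0, hn, hm] at h
    have hpos : n * m ≠ 0 := by
      intro h0
      rw [h0, zero_mul] at h
      have h1 : 0 < Nat.card (G₀₁ ν z) := Nat.card_pos
      rw [card_G₀₁ hz0] at h1
      omega
    rw [eq_div_iff (by exact_mod_cast hpos)]
    exact_mod_cast (mul_comm _ _).trans h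

end Orbits


/-! ### Counting automorphisms of an alternating form with marked functionals -/

section Counting

variable {F : Type*} [Field F]

variable {ι κ σ : Type*} [Fintype ι] [DecidableEq ι] [Fintype κ] [DecidableEq κ] [Fintype σ]
  [DecidableEq σ]

/-- Vectors in the radical of `K` on which the functionals `h` vanish. -/
def radSet (K : Matrix ι ι F) (h : Matrix ι κ F) : Set (ι → F) := {ρ | ρ ᵥ* K = 0 ∧ ρ ᵥ* h = 0}

/-- Vectors on which the functionals `h` vanish. -/
def kerSet (h : Matrix ι κ F) : Set (ι → F) := {w | w ᵥ* h = 0}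

theorem mem_isoSet_one {K : Matrix ι ι F} {h : Matrix ι κ F} {M : Matrix ι ι F} :
    M ∈ isoSet K h 1 ↔ IsUnit M.det ∧ M * K * Mᵀ = K ∧ M * h = h := by
  simp [isoSet]

theorem ncard_rows {S : Set (ι → F)} :
    {ω : Matrix σ ι F | ∀ i, ω i ∈ S}.ncard = S.ncard ^ Fintype.card σ := by
  rw [← Nat.card_coe_set_eq, ← Nat.card_coe_set_eq, ← Nat.card_eq_fintype_card, ← Nat.card_fun]
  exact Nat.card_congr
    { toFun := fun ω i => ⟨ω.1 i, ω.2 i⟩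
      invFun := fun f => ⟨fun i => (f i).1, fun i => (f i).2⟩
      left_inv := fun _ => rfl
      right_inv := fun _ => rfl }

theorem ncard_radSet_rows (K : Matrix ι ι F) (h : Matrix ι κ F) :
    {ω : Matrix σ ι F | ω * K = 0 ∧ ω * h = 0}.ncard = (radSet K h).ncard ^ Fintype.card σ := by
  rw [← ncard_rows]
  congr 1
  ext ω
  simp only [radSet, Set.mem_ofPred_eq, ← Matrix.ext_iff, funext_iff, Matrix.mul_apply_eq_vecMul]
  exact forall_and.symm

theorem ncard_kerSet_rows (h : Matrix ι κ F) :
    {ω : Matrix σ ι F | ω * h = 0}.ncard = (kerSet h).ncard ^ Fintype.card σ := by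
  rw [← ncard_rows]
  congr 1
  ext ω
  simp only [kerSet, Set.mem_ofPred_eq, ← Matrix.ext_iff, funext_iff, Matrix.mul_apply_eq_vecMul]
  rfl

theorem mul_transpose_eq_zero {K : Matrix ι ι F} (hK : Kᵀ = -K) {ω : Matrix σ ι F}
    (h : ω * K = 0) : K * ωᵀ = 0 := by
  have h' := congrArg transpose h
  rw [transpose_mul, hK, Matrix.neg_mul, transpose_zero, neg_eq_zero] at h'
  exact h'

/-- A summand on which all coordinates are marked contributes one vector of the marked radical of
the complement for each of its coordinates. -/
theorem ncard_isoSet_marked (A : Matrix σ σ F) {K : Matrix ι ι F} (hK : Kᵀ = -K)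
    (h : Matrix ι κ F) :
    (isoSet (fromBlocks A 0 0 K) (fromBlocks 1 0 0 h : Matrix (σ ⊕ ι) (σ ⊕ κ) F) 1).ncard =
      (radSet K h).ncard ^ Fintype.card σ * (isoSet K h 1).ncard := by
  have himage : isoSet (fromBlocks A 0 0 K) (fromBlocks 1 0 0 h : Matrix (σ ⊕ ι) (σ ⊕ κ) F) 1 =
      (fun p : Matrix σ ι F × Matrix ι ι F => fromBlocks 1 p.1 0 p.2) ''
        ({ω : Matrix σ ι F | ω * K = 0 ∧ ω * h = 0} ×ˢ isoSet K h 1) := by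
    ext M
    constructor
    · intro hM
      rw [mem_isoSet_one] at hM
      obtain ⟨hdet, hform, hmark⟩ := hM
      obtain ⟨a, b, c, d, rfl⟩ : ∃ a b c d, M = fromBlocks a b c d :=
        ⟨_, _, _, _, (fromBlocks_toBlocks M).symm⟩
      simp only [fromBlocks_multiply, Matrix.mul_one, Matrix.mul_zero, add_zero, zero_add,
        fromBlocks_inj] at hmark
      obtain ⟨rfl, hb, rfl, hd⟩ := hmark
      simp only [fromBlocks_multiply, fromBlocks_transpose, Matrix.mul_zero, Matrix.zero_mul,
        add_zero, zero_add, fromBlocks_inj, transpose_zero] at hform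
      rw [det_fromBlocks_zero₂₁, det_one, one_mul] at hdet
      refine ⟨(b, d), ⟨⟨?_, hb⟩, mem_isoSet_one.mpr ⟨hdet, hform.2.2.2, hd⟩⟩, rfl⟩
      have hdT : IsUnit dᵀ.det := by rwa [det_transpose]
      rw [← mul_nonsing_inv_cancel_right dᵀ (b * K) hdT, hform.2.1, Matrix.zero_mul]
    · rintro ⟨⟨ω, g⟩, ⟨hω, hg⟩, rfl⟩
      obtain ⟨h1, h2⟩ : ω * K = 0 ∧ ω * h = 0 := hω
      obtain ⟨hg1, hg2, hg3⟩ : IsUnit g.det ∧ g * K * gᵀ = K ∧ g * h = h := mem_isoSet_one.mp hg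
      have h3 : K * ωᵀ = 0 := mul_transpose_eq_zero hK h1
      refine mem_isoSet_one.mpr ⟨?_, ?_, ?_⟩
      · rw [det_fromBlocks_zero₂₁, det_one, one_mul]
        exact hg1
      · simp only [fromBlocks_transpose, fromBlocks_multiply]
        simp [h1, hg2, Matrix.mul_assoc g K, h3]
      · simp [fromBlocks_multiply, h2, hg3]
  rw [himage, Set.ncard_image_of_injective, Set.ncard_prod, ncard_radSet_rows]
  rintro ⟨ω, g⟩ ⟨ω', g'⟩ h
  obtain ⟨-, h1, -, h2⟩ := fromBlocks_inj.mp h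
  exact Prod.ext h1 h2

/-- The hyperbolic plane, with Gram matrix `(0 1; -1 0)`. -/
def hyp (F : Type*) [Field F] : Matrix (Unit ⊕ Unit) (Unit ⊕ Unit) F := fromBlocks 0 1 (-1) 0

/-- A matrix on `hyp ⊕ ι`, by its nine blocks. -/
def blocks3 (a b c d : Matrix Unit Unit F) (w ρ : Matrix Unit ι F) (u v : Matrix ι Unit F)
    (g : Matrix ι ι F) : Matrix ((Unit ⊕ Unit) ⊕ ι) ((Unit ⊕ Unit) ⊕ ι) F :=
  fromBlocks (fromBlocks a b c d) (fromRows w ρ) (fromCols u v) g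

theorem blocks3_inj {a b c d a' b' c' d' : Matrix Unit Unit F} {w ρ w' ρ' : Matrix Unit ι F}
    {u v u' v' : Matrix ι Unit F} {g g' : Matrix ι ι F} :
    blocks3 a b c d w ρ u v g = blocks3 a' b' c' d' w' ρ' u' v' g' ↔
      (a = a' ∧ b = b' ∧ c = c' ∧ d = d') ∧ (w = w' ∧ ρ = ρ') ∧ (u = u' ∧ v = v') ∧ g = g' := by
  simp only [blocks3, fromBlocks_inj, fromRows_ext_iff, fromCols_ext_iff]

theorem exists_eq_blocks3 (M : Matrix ((Unit ⊕ Unit) ⊕ ι) ((Unit ⊕ Unit) ⊕ ι) F) :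
    ∃ a b c d w ρ u v g, M = blocks3 a b c d w ρ u v g := by
  refine ⟨M.toBlocks₁₁.toBlocks₁₁, M.toBlocks₁₁.toBlocks₁₂, M.toBlocks₁₁.toBlocks₂₁,
    M.toBlocks₁₁.toBlocks₂₂, M.toBlocks₁₂.toRows₁, M.toBlocks₁₂.toRows₂, M.toBlocks₂₁.toCols₁,
    M.toBlocks₂₁.toCols₂, M.toBlocks₂₂, ?_⟩
  rw [blocks3, fromBlocks_toBlocks, fromRows_toRows, fromCols_toCols, fromBlocks_toBlocks]

theorem blocks3_transpose (a b c d : Matrix Unit Unit F) (w ρ : Matrix Unit ι F)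
    (u v : Matrix ι Unit F) (g : Matrix ι ι F) :
    (blocks3 a b c d w ρ u v g)ᵀ = blocks3 aᵀ cᵀ bᵀ dᵀ uᵀ vᵀ wᵀ ρᵀ gᵀ := by
  rw [blocks3, fromBlocks_transpose, fromBlocks_transpose, transpose_fromCols, transpose_fromRows,
    blocks3]

theorem blocks3_mul (a b c d a' b' c' d' : Matrix Unit Unit F) (w ρ w' ρ' : Matrix Unit ι F)
    (u v u' v' : Matrix ι Unit F) (g g' : Matrix ι ι F) :
    blocks3 a b c d w ρ u v g * blocks3 a' b' c' d' w' ρ' u' v' g' =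
      blocks3 (a * a' + b * c' + w * u') (a * b' + b * d' + w * v') (c * a' + d * c' + ρ * u')
        (c * b' + d * d' + ρ * v') (a * w' + b * ρ' + w * g') (c * w' + d * ρ' + ρ * g')
        (u * a' + v * c' + g * u') (u * b' + v * d' + g * v') (u * w' + v * ρ' + g * g') := by
  ext ((i | i) | i) ((j | j) | j) <;>
    simp [blocks3, Matrix.mul_apply, Fintype.sum_sum_type]

theorem hyp_sum_eq_blocks3 (K : Matrix ι ι F) :
    fromBlocks (hyp F) 0 0 K = blocks3 0 1 (-1) 0 0 0 0 0 K := by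
  ext ((i | i) | i) ((j | j) | j) <;> simp [blocks3, hyp]

theorem det_blocks3 (a b : Matrix Unit Unit F) (w ρ : Matrix Unit ι F) (u : Matrix ι Unit F)
    (g : Matrix ι ι F) (hb : b - ρ * u = 1) :
    (blocks3 1 a 0 b w ρ 0 (g * u) g).det = g.det := by
  have h1 : blocks3 1 a 0 b w ρ 0 (g * u) g * blocks3 1 0 0 1 0 0 0 (-u) 1 =
      blocks3 1 (a - w * u) 0 1 w ρ 0 0 g := by
    rw [blocks3_mul, blocks3_inj]
    simp [← sub_eq_add_neg, hb]
  have h0 : (0 : Matrix ι (Unit ⊕ Unit) F) = fromCols 0 0 := by ext i (j | j) <;> rfl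
  have h0' : (0 : Matrix (Unit ⊕ Unit) ι F) = fromRows 0 0 := by ext (j | j) i <;> rfl
  have h2 : (blocks3 1 0 0 1 0 0 0 (-u) (1 : Matrix ι ι F)).det = 1 := by
    rw [blocks3, ← h0', det_fromBlocks_zero₁₂, fromBlocks_one, det_one, det_one, one_mul]
  have h3 : (blocks3 1 (a - w * u) 0 1 w ρ 0 0 g).det = g.det := by
    rw [blocks3, ← h0, det_fromBlocks_zero₂₁, det_fromBlocks_zero₂₁, det_one, one_mul, one_mul]
  rw [← h3, ← h1, det_mul, h2, mul_one]

/-- The marked functionals on `hyp ⊕ K`: the first coordinate of the hyperbolic plane, and the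
functionals `h` of the second summand. -/
def hypMarks (h : Matrix ι κ F) : Matrix ((Unit ⊕ Unit) ⊕ ι) (Unit ⊕ κ) F :=
  fromBlocks (fromRows 1 0) 0 0 h

theorem blocks3_mul_hypMarks (a b c d : Matrix Unit Unit F) (w ρ : Matrix Unit ι F)
    (u v : Matrix ι Unit F) (g : Matrix ι ι F) (h : Matrix ι κ F) :
    blocks3 a b c d w ρ u v g * hypMarks h = hypMarks h ↔
      a = 1 ∧ c = 0 ∧ u = 0 ∧ w * h = 0 ∧ ρ * h = 0 ∧ g * h = h := by
  have e : blocks3 a b c d w ρ u v g * hypMarks h =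
      fromBlocks (fromRows a c) (fromRows (w * h) (ρ * h)) u (g * h) := by
    ext ((i | i) | i) (j | j) <;>
      simp [blocks3, hypMarks, Matrix.mul_apply, Fintype.sum_sum_type]
  have h0 : (0 : Matrix (Unit ⊕ Unit) κ F) = fromRows 0 0 := by ext (j | j) i <;> rfl
  rw [e, hypMarks, h0, fromBlocks_inj, fromRows_ext_iff, fromRows_ext_iff]
  tauto

theorem transpose_unit (a : Matrix Unit Unit F) : aᵀ = a := by
  ext; rfl

/-- An automorphism of `hyp ⊕ K` with marked first coordinate maps the hyperbolic basis vectors to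
`(1, λ, w)` and `(0, 1, ρ)` with `ρ` in the marked radical, and its action on the other summand is
determined by `w` and an automorphism of `K`. -/
theorem isoSet_hyp_eq_image (htwo : (2 : F) ≠ 0) {K : Matrix ι ι F} (hK : Kᵀ = -K)
    (h : Matrix ι κ F) :
    isoSet (fromBlocks (hyp F) 0 0 K) (hypMarks h) 1 =
      (fun p : (Matrix Unit Unit F × Matrix Unit ι F) × (Matrix Unit ι F × Matrix ι ι F) =>
        blocks3 1 p.1.1 0 1 p.1.2 p.2.1 0 (p.2.2 * (K * p.1.2ᵀ)) p.2.2) ''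
        ((Set.univ ×ˢ {w : Matrix Unit ι F | w * h = 0}) ×ˢ
          ({ρ : Matrix Unit ι F | ρ * K = 0 ∧ ρ * h = 0} ×ˢ isoSet K h 1)) := by
  have hself : ∀ w : Matrix Unit ι F, w * K * wᵀ = 0 := by
    intro w
    have e : (w * K * wᵀ)ᵀ = -(w * K * wᵀ) := by
      simp [transpose_mul, hK, Matrix.mul_assoc]
    rw [transpose_unit] at e
    ext i j
    have := congrFun (congrFun e i) j
    rw [Matrix.neg_apply, eq_neg_iff_add_eq_zero, ← two_mul] at this
    exact (mul_eq_zero.mp this).resolve_left htwo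
  ext M
  constructor
  · intro hM
    obtain ⟨hdet, hform, hmark⟩ := mem_isoSet_one.mp hM
    obtain ⟨a, b, c, d, w, ρ, u, v, g, rfl⟩ := exists_eq_blocks3 M
    obtain ⟨rfl, rfl, rfl, hw, hρ, hg⟩ := (blocks3_mul_hypMarks _ _ _ _ _ _ _ _ _ _).mp hmark
    rw [hyp_sum_eq_blocks3, blocks3_transpose, blocks3_mul, blocks3_mul, blocks3_inj] at hform
    simp only [Matrix.mul_zero, Matrix.zero_mul, add_zero, zero_add, Matrix.mul_one,
      Matrix.one_mul, Matrix.mul_neg, transpose_one, transpose_zero] at hform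
    obtain ⟨⟨-, h01, -, -⟩, ⟨h02, h12⟩, -, h22⟩ := hform
    have hv : v = g * (K * wᵀ) := by
      have := congrArg transpose (eq_neg_of_add_eq_zero_left h02)
      simpa [transpose_mul, hK, Matrix.mul_assoc] using this
    subst hv
    have hd : d - ρ * (K * wᵀ) = 1 := by
      rw [transpose_unit] at h01
      rw [← h01, sub_eq_add_neg]
      congr 1
      rw [← transpose_unit (w * K * ρᵀ)]
      simp [transpose_mul, hK, Matrix.mul_assoc]
    rw [det_blocks3 _ _ _ _ _ _ hd] at hdet
    have hgT : IsUnit gᵀ.det := by rwa [det_transpose]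
    have hρK : ρ * K = 0 := by
      rw [← mul_nonsing_inv_cancel_right gᵀ (ρ * K) hgT, h12, Matrix.zero_mul]
    have hd1 : d = 1 := by
      rw [← Matrix.mul_assoc, hρK, Matrix.zero_mul, sub_zero] at hd
      exact hd
    subst hd1
    exact ⟨((b, w), (ρ, g)), ⟨⟨trivial, hw⟩, ⟨hρK, hρ⟩, mem_isoSet_one.mpr ⟨hdet, h22, hg⟩⟩, rfl⟩
  · rintro ⟨⟨⟨l, w⟩, ⟨ρ, g⟩⟩, ⟨⟨-, hw⟩, ⟨hρ, hg⟩⟩, rfl⟩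
    replace hw : w * h = 0 := hw
    obtain ⟨h1, h2⟩ : ρ * K = 0 ∧ ρ * h = 0 := hρ
    obtain ⟨hg1, hg2, hg3⟩ : IsUnit g.det ∧ g * K * gᵀ = K ∧ g * h = h := mem_isoSet_one.mp hg
    refine mem_isoSet_one.mpr ⟨?_, ?_, ?_⟩
    · simp only
      rwa [det_blocks3]
      rw [← Matrix.mul_assoc, h1, Matrix.zero_mul, sub_zero]
    · have h3 := mul_transpose_eq_zero hK h1
      have h4 := hself w
      rw [Matrix.mul_assoc] at h4
      simp only
      rw [hyp_sum_eq_blocks3, blocks3_transpose, blocks3_mul, blocks3_mul, blocks3_inj]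
      simp [h1, h3, h4, hg2, transpose_mul, hK, Matrix.mul_assoc, transpose_unit l]
    · exact (blocks3_mul_hypMarks _ _ _ _ _ _ _ _ _ _).mpr ⟨rfl, rfl, rfl, hw, h2, hg3⟩

theorem ncard_isoSet_hyp (htwo : (2 : F) ≠ 0) {K : Matrix ι ι F} (hK : Kᵀ = -K)
    (h : Matrix ι κ F) :
    (isoSet (fromBlocks (hyp F) 0 0 K) (hypMarks h) 1).ncard =
      Nat.card F * (kerSet h).ncard * ((radSet K h).ncard * (isoSet K h 1).ncard) := by
  rw [isoSet_hyp_eq_image htwo hK, Set.ncard_image_of_injective, Set.ncard_prod, Set.ncard_prod,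
    Set.ncard_prod, ncard_radSet_rows, ncard_kerSet_rows, Set.ncard_univ]
  · have : Nat.card (Matrix Unit Unit F) = Nat.card F := by
      rw [Matrix, Nat.card_fun, Nat.card_fun]
      simp
    rw [this]
    simp
  · rintro ⟨⟨l, w⟩, ⟨ρ, g⟩⟩ ⟨⟨l', w'⟩, ⟨ρ', g'⟩⟩ h
    obtain ⟨⟨-, h1, -, -⟩, ⟨h2, h3⟩, -, h4⟩ := blocks3_inj.mp h
    exact Prod.ext (Prod.ext h1 h2) (Prod.ext h3 h4)

theorem ncard_radSet_hyp (K : Matrix ι ι F) (h : Matrix ι κ F) :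
    (radSet (fromBlocks (hyp F) 0 0 K) (hypMarks h)).ncard = (radSet K h).ncard := by
  have himage : radSet (fromBlocks (hyp F) 0 0 K) (hypMarks h) =
      (fun ρ : ι → F => Sum.elim (0 : Unit ⊕ Unit → F) ρ) '' radSet K h := by
    ext x
    simp only [radSet, hypMarks, hyp, vecMul_fromBlocks, Set.mem_ofPred_eq, Set.mem_image]
    constructor
    · rintro ⟨h1, h2⟩
      refine ⟨x ∘ Sum.inr, ⟨?_, ?_⟩, ?_⟩
      · ext i
        simpa using congrFun h1 (.inr i)
      · ext i
        simpa using congrFun h2 (.inr i)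
      · ext ((i | i) | i)
        · have := congrFun h1 (.inl (.inr i))
          simpa [eq_comm] using this
        · have := congrFun h1 (.inl (.inl i))
          simpa [eq_comm, vecMul_neg] using this
        · rfl
    · rintro ⟨ρ, ⟨h1, h2⟩, rfl⟩
      constructor
      · ext ((i | i) | i) <;> simp [h1]
      · ext (i | i) <;> simp [h2]
  rw [himage, Set.ncard_image_of_injective]
  intro ρ ρ' h
  ext i
  exact congrFun h (.inr i)

theorem ncard_kerSet_hyp (h : Matrix ι κ F) :
    (kerSet (hypMarks h)).ncard = Nat.card F * (kerSet h).ncard := by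
  have himage : kerSet (hypMarks h) =
      (fun p : F × (ι → F) =>
        Sum.elim (Sum.elim (0 : Unit → F) fun _ => p.1) p.2) '' (Set.univ ×ˢ kerSet h) := by
    ext x
    simp only [kerSet, hypMarks, vecMul_fromBlocks, Set.mem_ofPred_eq, Set.mem_image, Set.mem_prod]
    constructor
    · intro h1
      refine ⟨(x (.inl (.inr ())), x ∘ Sum.inr), ⟨trivial, ?_⟩, ?_⟩
      · ext i
        simpa using congrFun h1 (.inr i)
      · ext ((i | i) | i)
        · have := congrFun h1 (.inl i)
          simpa [eq_comm] using this
        · rfl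
        · rfl
    · rintro ⟨⟨c, w⟩, ⟨-, h1⟩, rfl⟩
      ext (i | i) <;> simp [h1]
  rw [himage, Set.ncard_image_of_injective, Set.ncard_prod, Set.ncard_univ]
  rintro ⟨c, w⟩ ⟨c', w'⟩ h
  refine Prod.ext (congrFun h (.inl (.inr ()))) ?_
  ext i
  exact congrFun h (.inr i)

/-! ### The unmarked form of given rank -/

/-- The alternating form of rank `2r` on `F^(2r+m)`, in coordinates adapted to its radical. -/
def stdForm (F : Type*) [Field F] (r m : ℕ) :
    Matrix ((Fin r ⊕ Fin r) ⊕ Fin m) ((Fin r ⊕ Fin r) ⊕ Fin m) F :=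
  fromBlocks (-J (Fin r) F) 0 0 0

/-- The empty family of functionals. -/
def noMarks (F : Type*) [Field F] (ι : Type*) : Matrix ι Empty F := 0

theorem stdForm_transpose (r m : ℕ) : (stdForm F r m)ᵀ = -stdForm F r m := by
  simp [stdForm, fromBlocks_transpose, fromBlocks_neg]

theorem noMarks_mul {ι : Type*} [Fintype ι] (M : Matrix σ ι F) : M * noMarks F ι = noMarks F σ := by
  ext i j
  exact j.elim

theorem isoSet_stdForm_eq_image (r m : ℕ) :
    isoSet (stdForm F r m) (noMarks F _) 1 =
      (fun p : Matrix (Fin r ⊕ Fin r) (Fin r ⊕ Fin r) F ×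
          (Matrix (Fin r ⊕ Fin r) (Fin m) F × Matrix (Fin m) (Fin m) F) =>
        fromBlocks p.1 p.2.1 0 p.2.2) ''
        ((symplecticGroup (Fin r) F : Set (Matrix (Fin r ⊕ Fin r) (Fin r ⊕ Fin r) F)) ×ˢ
          (Set.univ ×ˢ {d | IsUnit d.det})) := by
  ext M
  constructor
  · intro hM
    obtain ⟨hdet, hform, -⟩ := mem_isoSet_one.mp hM
    obtain ⟨a, b, c, d, rfl⟩ : ∃ a b c d, M = fromBlocks a b c d :=
      ⟨_, _, _, _, (fromBlocks_toBlocks M).symm⟩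
    simp only [stdForm, fromBlocks_multiply, fromBlocks_transpose, fromBlocks_inj,
      Matrix.mul_zero, Matrix.zero_mul, add_zero, Matrix.mul_neg, Matrix.neg_mul, neg_inj] at hform
    have ha : a ∈ symplecticGroup (Fin r) F := SymplecticGroup.mem_iff.mpr hform.1
    have hau : IsUnit a.det := SymplecticGroup.symplectic_det ha
    have hc : c = 0 := by
      have h1 : a * J (Fin r) F * cᵀ = 0 := neg_eq_zero.mp hform.2.1
      have hJ : IsUnit (a * J (Fin r) F).det := by
        rw [det_mul]
        exact hau.mul (isUnit_det_J _ _)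
      have h2 : cᵀ = 0 := by
        rw [← nonsing_inv_mul_cancel_left _ cᵀ hJ, h1, Matrix.mul_zero]
      rw [← transpose_transpose c, h2, transpose_zero]
    subst hc
    rw [det_fromBlocks_zero₂₁] at hdet
    exact ⟨(a, b, d), ⟨ha, trivial, isUnit_of_mul_isUnit_right hdet⟩, rfl⟩
  · rintro ⟨⟨a, b, d⟩, ⟨ha, -, hd⟩, rfl⟩
    refine mem_isoSet_one.mpr ⟨?_, ?_, noMarks_mul _⟩
    · rw [det_fromBlocks_zero₂₁]
      exact (SymplecticGroup.symplectic_det ha).mul hd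
    · have := SymplecticGroup.mem_iff.mp ha
      simp [stdForm, fromBlocks_multiply, fromBlocks_transpose, this]

theorem ncard_isoSet_stdForm (r m : ℕ) :
    (isoSet (stdForm F r m) (noMarks F _) 1).ncard =
      cardSp F r * (Nat.card F ^ (2 * r * m) * cardGL F m) := by
  rw [isoSet_stdForm_eq_image, Set.ncard_image_of_injective, Set.ncard_prod, Set.ncard_prod,
    Set.ncard_univ, ncard_isUnit_det, ← Nat.card_coe_set_eq]
  · congr 2
    rw [Matrix, Nat.card_fun, Nat.card_fun]
    simp only [Nat.card_eq_fintype_card, Fintype.card_sum, Fintype.card_fin]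
    rw [← pow_mul]
    congr 1
    ring
  · rintro ⟨a, b, d⟩ ⟨a', b', d'⟩ h
    obtain ⟨h1, h2, -, h3⟩ := fromBlocks_inj.mp h
    exact Prod.ext h1 (Prod.ext h2 h3)

theorem ncard_radSet_stdForm (r m : ℕ) :
    (radSet (stdForm F r m) (noMarks F _)).ncard = Nat.card F ^ m := by
  have himage : radSet (stdForm F r m) (noMarks F _) =
      (fun y : Fin m → F => Sum.elim (0 : Fin r ⊕ Fin r → F) y) '' Set.univ := by
    ext x
    constructor
    · rintro ⟨h, -⟩
      refine ⟨x ∘ Sum.inr, trivial, ?_⟩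
      have h1 : (x ∘ Sum.inl) ᵥ* J (Fin r) F = 0 := by
        ext i
        have := congrFun h (.inl i)
        simpa [stdForm, vecMul_fromBlocks, vecMul_neg] using this
      have h2 : x ∘ Sum.inl = 0 := by
        have := congrArg (fun y => y ᵥ* J (Fin r) F) h1
        simpa [vecMul_vecMul, J_squared, vecMul_neg] using this
      ext (i | i)
      · exact (congrFun h2 i).symm
      · rfl
    · rintro ⟨y, -, rfl⟩
      refine ⟨?_, ?_⟩
      · ext (i | i) <;> simp [stdForm, vecMul_fromBlocks]
      · ext i
        exact i.elim
  rw [himage, Set.ncard_image_of_injective, Set.ncard_univ, Nat.card_fun]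
  · simp
  · intro y y' h
    ext i
    exact congrFun h (.inr i)

theorem ncard_kerSet_stdForm (r m : ℕ) :
    (kerSet (noMarks F ((Fin r ⊕ Fin r) ⊕ Fin m))).ncard = Nat.card F ^ (2 * r + m) := by
  have : kerSet (noMarks F ((Fin r ⊕ Fin r) ⊕ Fin m)) = Set.univ := by
    ext x
    refine ⟨fun _ => trivial, fun _ => ?_⟩
    ext i
    exact i.elim
  rw [this, Set.ncard_univ, Nat.card_fun]
  simp [two_mul]

end Counting


/-! ### The orthogonal group of the definite plane -/

section OrthDelta

variable {F : Type*} [Field F]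

/-- The conic `x² - z y² = 1`. -/
def conic (z : F) : Set (F × F) := {p | p.1 ^ 2 - z * p.2 ^ 2 = 1}

/-- The matrix with first row `p` and determinant `t`, for `p` on the conic. -/
def deltaMat (z : F) (p : F × F) (t : F) : Matrix (Fin 2) (Fin 2) F :=
  !![p.1, p.2; t * z * p.2, t * p.1]

theorem deltaMat_mem {z : F} {p : F × F} (hp : p ∈ conic z) {t : F} (ht : t ^ 2 = 1) :
    deltaMat z p t ∈ orthDelta z := by
  replace hp : p.1 ^ 2 - z * p.2 ^ 2 = 1 := hp
  change deltaMat z p t * Δ z * (deltaMat z p t)ᵀ = Δ z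
  ext i j
  fin_cases i <;> fin_cases j <;>
    simp [deltaMat, Δ, Matrix.mul_apply, Fin.sum_univ_two, vecMul_diagonal]
  · linear_combination hp
  · ring
  · ring
  · linear_combination (-z * t ^ 2) * hp - z * ht

theorem det_deltaMat {z : F} {p : F × F} (hp : p ∈ conic z) (t : F) :
    (deltaMat z p t).det = t := by
  replace hp : p.1 ^ 2 - z * p.2 ^ 2 = 1 := hp
  rw [deltaMat, Matrix.det_fin_two_of]
  linear_combination t * hp

theorem exists_eq_deltaMat {z : F} (hz0 : z ≠ 0) {D : Matrix (Fin 2) (Fin 2) F}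
    (hD : D ∈ orthDelta z) : ∃ p ∈ conic z, ∃ t, (t = 1 ∨ t = -1) ∧ D = deltaMat z p t := by
  have hD' : D * Δ z * Dᵀ = Δ z := hD
  have h00 := congrFun (congrFun hD' 0) 0
  have h01 := congrFun (congrFun hD' 0) 1
  have h11 := congrFun (congrFun hD' 1) 1
  simp [Δ, Matrix.mul_apply, Fin.sum_univ_two, Matrix.diagonal_apply] at h00 h01 h11
  -- the second row is orthogonal to the first one, hence a multiple of `(z D₀₁, D₀₀)`
  set t := D 0 0 * D 1 1 - D 0 1 * D 1 0 with ht
  have h10' : D 1 0 = t * z * D 0 1 := by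
    rw [ht]
    linear_combination (-D 1 0) * h00 + D 0 0 * h01
  have h11' : D 1 1 = t * D 0 0 := by
    rw [ht]
    have : z * D 1 1 = z * ((D 0 0 * D 1 1 - D 0 1 * D 1 0) * D 0 0) := by
      linear_combination (-z * D 1 1) * h00 + z * D 0 1 * h01
    exact mul_left_cancel₀ hz0 this
  have htt : t ^ 2 = 1 := by
    rw [h10', h11'] at h11
    have : z * t ^ 2 = z * 1 := by linear_combination (-1 : F) * h11 - z * t ^ 2 * h00
    exact mul_left_cancel₀ hz0 this
  refine ⟨(D 0 0, D 0 1), ?_, t, mul_self_eq_one_iff.mp ((sq t).symm.trans htt), ?_⟩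
  · change D 0 0 ^ 2 - z * D 0 1 ^ 2 = 1
    linear_combination h00
  · ext i j
    fin_cases i <;> fin_cases j <;> simp [deltaMat, h10', h11']

/-- Stereographic projection from `(-1, 0)` counts the points of the conic. -/
theorem ncard_conic [Finite F] {z : F} (hz : ¬ IsSquare z) (h2 : (2 : F) ≠ 0) :
    (conic z).ncard = Nat.card F + 1 := by
  have hne : ∀ t : F, 1 - z * t ^ 2 ≠ 0 := by
    intro t h
    have := anisotropic hz (s := 1) (t := t) (by linear_combination h)
    exact one_ne_zero this.1
  set g : F → F × F := fun t => ((1 + z * t ^ 2) / (1 - z * t ^ 2), 2 * t / (1 - z * t ^ 2)) with hg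
  have hsum : ∀ t, 1 + (g t).1 = 2 / (1 - z * t ^ 2) := by
    intro t
    have := hne t
    simp only [hg]
    field_simp
    ring
  have hinv : ∀ t, (g t).2 / (1 + (g t).1) = t := by
    intro t
    have := hne t
    rw [hsum]
    simp only [hg]
    rw [div_div_div_cancel_right₀ this, mul_div_cancel_left₀ _ h2]
  have hset : conic z = insert (-1, 0) (Set.range g) := by
    ext ⟨x, y⟩
    simp only [conic, Set.mem_ofPred_eq, Set.mem_insert_iff, Set.mem_range]
    constructor
    · intro h
      by_cases hx : 1 + x = 0
      · left
        have hx' : x = -1 := by linear_combination hx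
        have hz0 : z ≠ 0 := by rintro rfl; exact hz IsSquare.zero
        have hy : z * y ^ 2 = 0 := by rw [hx'] at h; linear_combination -h
        have hy' : y = 0 := by simpa [hz0] using hy
        rw [hx', hy']
      · right
        refine ⟨y / (1 + x), ?_⟩
        have hd : 1 - z * (y / (1 + x)) ^ 2 = 2 / (1 + x) := by
          field_simp
          linear_combination h
        have hn : 1 + z * (y / (1 + x)) ^ 2 = 2 * x / (1 + x) := by
          field_simp
          linear_combination -h
        simp only [hg]
        rw [hd, hn]
        ext <;> field_simp
    · rintro (h | ⟨t, h⟩)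
      · obtain ⟨rfl, rfl⟩ := Prod.mk.inj h
        ring
      · obtain ⟨rfl, rfl⟩ := Prod.mk.inj h
        have := hne t
        field_simp
        ring
  rw [hset, Set.ncard_insert_of_notMem, ← Set.image_univ, Set.ncard_image_of_injective,
    Set.ncard_univ]
  · intro t t' h
    rw [← hinv t, ← hinv t', h]
  · rintro ⟨t, ht⟩
    have h := hsum t
    rw [ht] at h
    have := div_ne_zero h2 (hne t)
    exact this (by rw [← h]; ring)

theorem deltaMat_injOn (z : F) {p p' : F × F} (hp : p ∈ conic z) (hp' : p' ∈ conic z) {t t' : F}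
    (h : deltaMat z p t = deltaMat z p' t') : p = p' ∧ t = t' := by
  refine ⟨Prod.ext (congrFun (congrFun h 0) 0) (congrFun (congrFun h 0) 1), ?_⟩
  rw [← det_deltaMat hp t, ← det_deltaMat hp' t', h]

theorem ncard_one_neg_one (h2 : (2 : F) ≠ 0) : ({1, -1} : Set F).ncard = 2 := by
  rw [Set.ncard_pair]
  intro h
  exact h2 (by linear_combination h)

theorem ncard_orthDelta [Finite F] {z : F} (hz : ¬ IsSquare z) (h2 : (2 : F) ≠ 0) :
    (orthDelta z).ncard = 2 * (Nat.card F + 1) := by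
  have hz0 : z ≠ 0 := by rintro rfl; exact hz IsSquare.zero
  have himage : orthDelta z = (fun p : (F × F) × F => deltaMat z p.1 p.2) ''
      (conic z ×ˢ ({1, -1} : Set F)) := by
    ext D
    constructor
    · intro hD
      obtain ⟨p, hp, t, ht, rfl⟩ := exists_eq_deltaMat hz0 hD
      exact ⟨(p, t), ⟨hp, ht⟩, rfl⟩
    · rintro ⟨⟨p, t⟩, ⟨hp, ht⟩, rfl⟩
      refine deltaMat_mem hp ?_
      rcases ht with rfl | rfl <;> ring
  rw [himage, Set.InjOn.ncard_image, Set.ncard_prod, ncard_conic hz h2, ncard_one_neg_one h2,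
    mul_comm]
  rintro ⟨p, t⟩ ⟨hp, -⟩ ⟨p', t'⟩ ⟨hp', -⟩ h
  obtain ⟨h1, h3⟩ := deltaMat_injOn z hp hp' h
  exact Prod.ext h1 h3

theorem ncard_orthDelta_det_one [Finite F] {z : F} (hz : ¬ IsSquare z) (h2 : (2 : F) ≠ 0) :
    {D | D ∈ orthDelta z ∧ D.det = 1}.ncard = Nat.card F + 1 := by
  have hz0 : z ≠ 0 := by rintro rfl; exact hz IsSquare.zero
  have himage : {D | D ∈ orthDelta z ∧ D.det = 1} = (fun p : F × F => deltaMat z p 1) ''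
      conic z := by
    ext D
    constructor
    · rintro ⟨hD, hdet⟩
      obtain ⟨p, hp, t, ht, rfl⟩ := exists_eq_deltaMat hz0 hD
      rw [det_deltaMat hp] at hdet
      subst hdet
      exact ⟨p, hp, rfl⟩
    · rintro ⟨p, hp, rfl⟩
      exact ⟨deltaMat_mem hp (one_pow 2), det_deltaMat hp 1⟩
  rw [himage, Set.InjOn.ncard_image, ncard_conic hz h2]
  intro p hp p' hp' h
  exact (deltaMat_injOn z hp hp' h).1

/-- The group generated by `-1` and a reflection has order four. -/
theorem ncard_klein {z : F} (h2 : (2 : F) ≠ 0) {p : F × F} (hp : p ∈ conic z) :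
    ({1, -1, deltaMat z p (-1), -deltaMat z p (-1)} : Set (Matrix (Fin 2) (Fin 2) F)).ncard
      = 4 := by
  have hdet : (deltaMat z p (-1)).det = -1 := det_deltaMat hp _
  have hdet' : (-deltaMat z p (-1)).det = -1 := by
    rw [det_neg, hdet]
    simp
  have hd1 : (-1 : Matrix (Fin 2) (Fin 2) F).det = 1 := by
    rw [det_neg, det_one]
    simp
  have h11 : (1 : F) ≠ -1 := fun h => h2 (by linear_combination h)
  have a : (1 : Matrix (Fin 2) (Fin 2) F) ≠ -1 := fun h => h11 (congrFun (congrFun h 0) 0)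
  have b : deltaMat z p (-1) ≠ -deltaMat z p (-1) := by
    intro h
    have e0 : p.1 = -p.1 := congrFun (congrFun h 0) 0
    have e1 : p.2 = -p.2 := congrFun (congrFun h 0) 1
    have f0 : p.1 = 0 := (mul_eq_zero.mp (by linear_combination e0 : 2 * p.1 = 0)).resolve_left h2
    have f1 : p.2 = 0 := (mul_eq_zero.mp (by linear_combination e1 : 2 * p.2 = 0)).resolve_left h2
    have : p.1 ^ 2 - z * p.2 ^ 2 = 1 := hp
    rw [f0, f1] at this
    simp at this
  have hneq : ∀ {X Y : Matrix (Fin 2) (Fin 2) F}, X.det = 1 → Y.det = -1 → X ≠ Y := by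
    rintro X Y hX hY rfl
    exact h11 (hX.symm.trans hY)
  rw [Set.ncard_insert_of_notMem, Set.ncard_insert_of_notMem, Set.ncard_pair b]
  · rintro (h | h)
    · exact hneq hd1 hdet h
    · exact hneq hd1 hdet' h
  · rintro (h | h | h)
    · exact a h
    · exact hneq det_one hdet h
    · exact hneq det_one hdet' h

end OrthDelta


/-! ### Change of coordinates -/

section Transport

variable {F : Type*} [Field F]

variable {ι ι' κ κ' : Type*} [Fintype ι] [DecidableEq ι] [Fintype ι'] [DecidableEq ι']
  [Fintype κ] [DecidableEq κ] [Fintype κ'] [DecidableEq κ']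

theorem conj_mem_isoSet {P : Matrix ι' ι F} {Q : Matrix ι ι' F} (hPQ : P * Q = 1) (hQP : Q * P = 1)
    {K : Matrix ι ι F} {Z : Matrix ι κ F} {D : Matrix κ κ F} {M : Matrix ι ι F}
    (hM : M ∈ isoSet K Z D) : P * M * Q ∈ isoSet (P * K * Pᵀ) (P * Z) D := by
  obtain ⟨hu, hK, hZ⟩ := hM
  refine ⟨?_, ?_, ?_⟩
  · refine Matrix.isUnit_det_of_right_inverse (B := P * M⁻¹ * Q) ?_
    calc P * M * Q * (P * M⁻¹ * Q) = P * (M * ((Q * P) * M⁻¹)) * Q := by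
          simp only [Matrix.mul_assoc]
      _ = 1 := by rw [hQP, Matrix.one_mul, mul_nonsing_inv _ hu, Matrix.mul_one, hPQ]
  · calc P * M * Q * (P * K * Pᵀ) * (P * M * Q)ᵀ
        = P * (M * ((Q * P) * K * (Q * P)ᵀ) * Mᵀ) * Pᵀ := by
          simp only [Matrix.mul_assoc, transpose_mul]
      _ = P * K * Pᵀ := by rw [hQP, Matrix.one_mul, transpose_one, Matrix.mul_one, hK]
  · calc P * M * Q * (P * Z) * D = P * (M * ((Q * P) * Z) * D) := by
          simp only [Matrix.mul_assoc]
      _ = P * Z := by rw [hQP, Matrix.one_mul, hZ]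

theorem isoSet_conj_eq_image {P : Matrix ι' ι F} {Q : Matrix ι ι' F} (hPQ : P * Q = 1)
    (hQP : Q * P = 1) (K : Matrix ι ι F) (Z : Matrix ι κ F) (D : Matrix κ κ F) :
    isoSet (P * K * Pᵀ) (P * Z) D = (fun M => P * M * Q) '' isoSet K Z D := by
  ext M
  constructor
  · intro hM
    have h := conj_mem_isoSet hQP hPQ hM
    have e1 : Q * (P * K * Pᵀ) * Qᵀ = K := by
      calc Q * (P * K * Pᵀ) * Qᵀ = (Q * P) * K * (Q * P)ᵀ := by
            simp only [Matrix.mul_assoc, transpose_mul]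
        _ = K := by rw [hQP, Matrix.one_mul, transpose_one, Matrix.mul_one]
    have e2 : Q * (P * Z) = Z := by rw [← Matrix.mul_assoc, hQP, Matrix.one_mul]
    rw [e1, e2] at h
    refine ⟨_, h, ?_⟩
    calc P * (Q * M * P) * Q = (P * Q) * M * (P * Q) := by simp only [Matrix.mul_assoc]
      _ = M := by rw [hPQ, Matrix.one_mul, Matrix.mul_one]
  · rintro ⟨M, hM, rfl⟩
    exact conj_mem_isoSet hPQ hQP hM

theorem ncard_isoSet_conj {P : Matrix ι' ι F} {Q : Matrix ι ι' F} (hPQ : P * Q = 1)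
    (hQP : Q * P = 1) (K : Matrix ι ι F) (Z : Matrix ι κ F) (D : Matrix κ κ F) :
    (isoSet (P * K * Pᵀ) (P * Z) D).ncard = (isoSet K Z D).ncard := by
  rw [isoSet_conj_eq_image hPQ hQP, Set.ncard_image_of_injective]
  intro M M' h
  have e : ∀ M : Matrix ι ι F, Q * (P * M * Q) * P = M := by
    intro M
    calc Q * (P * M * Q) * P = (Q * P) * M * (Q * P) := by simp only [Matrix.mul_assoc]
      _ = M := by rw [hQP, Matrix.one_mul, Matrix.mul_one]
  replace h : P * M * Q = P * M' * Q := h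
  rw [← e M, h, e]

/-- The permutation matrix of `e`. -/
def permMat (F : Type*) [Field F] (e : ι' ≃ ι) : Matrix ι' ι F :=
  (1 : Matrix ι ι F).submatrix e id

theorem permMat_mul (e : ι' ≃ ι) (Z : Matrix ι κ F) : permMat F e * Z = Z.submatrix e id := by
  ext i j
  simp [permMat, Matrix.mul_apply, Matrix.one_apply]

theorem permMat_conj (e : ι' ≃ ι) (K : Matrix ι ι F) :
    permMat F e * K * (permMat F e)ᵀ = K.submatrix e e := by
  rw [permMat_mul]
  ext i j
  simp [permMat, Matrix.mul_apply, Matrix.one_apply]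

theorem permMat_mul_permMat_symm (e : ι' ≃ ι) : permMat F e * permMat F e.symm = 1 := by
  rw [permMat_mul, permMat]
  ext i j
  simp [Matrix.one_apply]

theorem ncard_isoSet_submatrix (e : ι' ≃ ι) (K : Matrix ι ι F) (Z : Matrix ι κ F)
    (D : Matrix κ κ F) :
    (isoSet (K.submatrix e e) (Z.submatrix e id) D).ncard = (isoSet K Z D).ncard := by
  rw [← permMat_conj, ← permMat_mul]
  exact ncard_isoSet_conj (permMat_mul_permMat_symm e) (permMat_mul_permMat_symm e.symm) K Z D

theorem admissible_submatrix (e : ι' ≃ ι) (z : F) (K : Matrix ι ι F) (Z : Matrix ι (Fin 2) F) :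
    admissible z (K.submatrix e e) (Z.submatrix e id) = admissible z K Z := by
  ext D
  rw [← permMat_conj, ← permMat_mul]
  simp only [admissible, Set.mem_ofPred_eq]
  rw [isoSet_conj_eq_image (permMat_mul_permMat_symm e) (permMat_mul_permMat_symm e.symm),
    Set.image_nonempty]

/-- Only the span of the marked functionals matters. -/
theorem isoSet_mul_right (K : Matrix ι ι F) (h : Matrix ι κ F) {C : Matrix κ κ' F}
    {C' : Matrix κ' κ F} (hC : C * C' = 1) : isoSet K (h * C) 1 = isoSet K h 1 := by
  ext M
  rw [mem_isoSet_one, mem_isoSet_one]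
  refine and_congr_right fun _ => and_congr_right fun _ => ⟨fun e => ?_, fun e => ?_⟩
  · have := congrArg (· * C') e
    simpa only [Matrix.mul_assoc, hC, Matrix.mul_one] using this
  · rw [← Matrix.mul_assoc, e]

end Transport

/-! ### Forms supported on a few coordinates and a standard complement -/

section Model

variable {F : Type*} [Field F]

/-- Coordinates of the standard form. -/
abbrev StdIdx (r m : ℕ) : Type := (Fin r ⊕ Fin r) ⊕ Fin m

/-- The orthogonal sum of a form `A` on a few coordinates and a standard form. -/
def modelForm {σ : Type*} (A : Matrix σ σ F) (r m : ℕ) :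
    Matrix (σ ⊕ StdIdx r m) (σ ⊕ StdIdx r m) F :=
  fromBlocks A 0 0 (stdForm F r m)

/-- Columns supported on the first summand. -/
def modelCols {σ κ : Type*} (B : Matrix σ κ F) (r m : ℕ) : Matrix (σ ⊕ StdIdx r m) κ F :=
  fromRows B 0

variable {σ τ κ : Type*} [Fintype σ] [DecidableEq σ] [Fintype τ] [DecidableEq τ] [Fintype κ]
  [DecidableEq κ]

theorem ncard_isoSet_model_submatrix (ε : τ ≃ σ) (A : Matrix σ σ F) (B : Matrix σ κ F) (r m : ℕ) :
    (isoSet (modelForm (A.submatrix ε ε) r m) (modelCols (B.submatrix ε id) r m) 1).ncard =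
      (isoSet (modelForm A r m) (modelCols B r m) 1).ncard := by
  rw [← ncard_isoSet_submatrix (Equiv.sumCongr ε (Equiv.refl (StdIdx r m)))]
  congr 2
  · ext (i | i) (j | j) <;> rfl
  · ext (i | i) j <;> rfl

/-- All coordinates of the first summand are marked. -/
theorem ncard_isoSet_model_marked (A : Matrix σ σ F) {B : Matrix σ κ F} {B' : Matrix κ σ F}
    (hB : B * B' = 1) (r m : ℕ) :
    (isoSet (modelForm A r m) (modelCols B r m) 1).ncard =
      (Nat.card F ^ m) ^ Fintype.card σ *
        (cardSp F r * (Nat.card F ^ (2 * r * m) * cardGL F m)) := by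
  have e : modelCols B r m = (fromBlocks 1 0 0 (noMarks F _) :
      Matrix (σ ⊕ StdIdx r m) (σ ⊕ Empty) F) *
        (fromRows B 0 : Matrix (σ ⊕ Empty) κ F) := by
    rw [fromBlocks_mul_fromRows, modelCols]
    simp
  rw [e, isoSet_mul_right (C' := fromCols B' 0), modelForm,
    ncard_isoSet_marked A (stdForm_transpose r m), ncard_isoSet_stdForm, ncard_radSet_stdForm]
  rw [fromRows_mul_fromCols, hB]
  ext (i | i) (j | j) <;> first | exact i.elim | exact j.elim | simp [Matrix.one_apply]

/-- One marked functional vanishing on the radical: a coordinate of a hyperbolic plane. -/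
theorem ncard_isoSet_model_hyp (h2 : (2 : F) ≠ 0) {B : Matrix (Unit ⊕ Unit) κ F}
    {c : Matrix Unit κ F} {c' : Matrix κ Unit F} (hB : B = fromRows c 0) (hc : c * c' = 1)
    (r m : ℕ) :
    (isoSet (modelForm (hyp F) r m) (modelCols B r m) 1).ncard =
      Nat.card F * Nat.card F ^ (2 * r + m) *
        (Nat.card F ^ m * (cardSp F r * (Nat.card F ^ (2 * r * m) * cardGL F m))) := by
  have e : modelCols B r m = hypMarks (noMarks F (StdIdx r m)) *
      (fromRows c 0 : Matrix (Unit ⊕ Empty) κ F) := by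
    rw [hypMarks, fromBlocks_mul_fromRows, modelCols, hB, fromRows_mul]
    simp
  rw [e, isoSet_mul_right (C' := fromCols c' 0), modelForm,
    ncard_isoSet_hyp h2 (stdForm_transpose r m), ncard_isoSet_stdForm, ncard_radSet_stdForm,
    ncard_kerSet_stdForm]
  rw [fromRows_mul_fromCols, hc]
  ext (i | i) (j | j) <;> first | exact i.elim | exact j.elim | simp

theorem hyp_sum_transpose {ι : Type*} {K : Matrix ι ι F} (hK : Kᵀ = -K) :
    (fromBlocks (hyp F) 0 0 K)ᵀ = -fromBlocks (hyp F) 0 0 K := by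
  simp [hyp, fromBlocks_transpose, fromBlocks_neg, hK]

/-- Two marked functionals, one of which vanishes on the radical while the other does not. -/
theorem ncard_isoSet_model_unit_hyp (h2 : (2 : F) ≠ 0) {B : Matrix (Unit ⊕ (Unit ⊕ Unit)) κ F}
    {c d : Matrix Unit κ F} {c' d' : Matrix κ Unit F} (hB : B = fromRows c (fromRows d 0))
    (hcc : c * c' = 1) (hcd : c * d' = 0) (hdc : d * c' = 0) (hdd : d * d' = 1) (r m : ℕ) :
    (isoSet (modelForm (fromBlocks 0 0 0 (hyp F)) r m) (modelCols B r m) 1).ncard =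
      Nat.card F ^ m * (Nat.card F * Nat.card F ^ (2 * r + m) *
        (Nat.card F ^ m * (cardSp F r * (Nat.card F ^ (2 * r * m) * cardGL F m)))) := by
  have e1 : (modelForm (fromBlocks (0 : Matrix Unit Unit F) 0 0 (hyp F)) r m).submatrix
      (Equiv.sumAssoc Unit (Unit ⊕ Unit) (StdIdx r m)).symm
      (Equiv.sumAssoc Unit (Unit ⊕ Unit) (StdIdx r m)).symm =
      fromBlocks 0 0 0 (fromBlocks (hyp F) 0 0 (stdForm F r m)) := by
    ext (i | i | i) (j | j | j) <;> rfl
  have e2 : (modelCols B r m).submatrix (Equiv.sumAssoc Unit (Unit ⊕ Unit) (StdIdx r m)).symm id =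
      (fromBlocks 1 0 0 (hypMarks (noMarks F (StdIdx r m))) :
        Matrix _ (Unit ⊕ (Unit ⊕ Empty)) F) *
        (fromRows c (fromRows d 0) : Matrix (Unit ⊕ (Unit ⊕ Empty)) κ F) := by
    rw [fromBlocks_mul_fromRows, hypMarks, fromBlocks_mul_fromRows, fromRows_mul, hB]
    ext (i | (i | i) | i) j <;> simp [modelCols]
  rw [← ncard_isoSet_submatrix (Equiv.sumAssoc Unit (Unit ⊕ Unit) (StdIdx r m)).symm, e1, e2,
    isoSet_mul_right (C' := fromCols c' (fromCols d' 0)),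
    ncard_isoSet_marked _ (hyp_sum_transpose (stdForm_transpose r m)),
    ncard_isoSet_hyp h2 (stdForm_transpose r m), ncard_radSet_hyp, ncard_isoSet_stdForm,
    ncard_radSet_stdForm, ncard_kerSet_stdForm, Fintype.card_unit, pow_one]
  rw [fromRows_mul_fromCols, fromRows_mul, mul_fromCols, mul_fromCols, fromRows_mul]
  rw [hcc, hcd, hdc, hdd]
  ext (i | i | i) (j | j | j) <;> first | exact i.elim | exact j.elim | simp

/-- Two marked functionals, represented by vectors that span an isotropic plane: two hyperbolic
planes with one marked coordinate each. -/
theorem ncard_isoSet_model_hyp_hyp (h2 : (2 : F) ≠ 0)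
    {B : Matrix ((Unit ⊕ Unit) ⊕ (Unit ⊕ Unit)) κ F}
    {c d : Matrix Unit κ F} {c' d' : Matrix κ Unit F}
    (hB : B = fromRows (fromRows c 0) (fromRows d 0))
    (hcc : c * c' = 1) (hcd : c * d' = 0) (hdc : d * c' = 0) (hdd : d * d' = 1) (r m : ℕ) :
    (isoSet (modelForm (fromBlocks (hyp F) 0 0 (hyp F)) r m) (modelCols B r m) 1).ncard =
      Nat.card F * (Nat.card F * Nat.card F ^ (2 * r + m)) * (Nat.card F ^ m *
      (Nat.card F * Nat.card F ^ (2 * r + m) *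
        (Nat.card F ^ m * (cardSp F r * (Nat.card F ^ (2 * r * m) * cardGL F m))))) := by
  have e1 : (modelForm (fromBlocks (hyp F) 0 0 (hyp F)) r m).submatrix
      (Equiv.sumAssoc (Unit ⊕ Unit) (Unit ⊕ Unit) (StdIdx r m)).symm
      (Equiv.sumAssoc (Unit ⊕ Unit) (Unit ⊕ Unit) (StdIdx r m)).symm =
      fromBlocks (hyp F) 0 0 (fromBlocks (hyp F) 0 0 (stdForm F r m)) := by
    ext (i | i | i) (j | j | j) <;> rfl
  have e2 : (modelCols B r m).submatrix
      (Equiv.sumAssoc (Unit ⊕ Unit) (Unit ⊕ Unit) (StdIdx r m)).symm id =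
      hypMarks (hypMarks (noMarks F (StdIdx r m))) *
        (fromRows c (fromRows d 0) : Matrix (Unit ⊕ (Unit ⊕ Empty)) κ F) := by
    rw [hypMarks, fromBlocks_mul_fromRows, hypMarks, fromBlocks_mul_fromRows, fromRows_mul,
      fromRows_mul, hB]
    ext ((i | i) | (i | i) | i) j <;> simp [modelCols]
  rw [← ncard_isoSet_submatrix (Equiv.sumAssoc (Unit ⊕ Unit) (Unit ⊕ Unit) (StdIdx r m)).symm, e1,
    e2, isoSet_mul_right (C' := fromCols c' (fromCols d' 0)),
    ncard_isoSet_hyp h2 (hyp_sum_transpose (stdForm_transpose r m)),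
    ncard_isoSet_hyp h2 (stdForm_transpose r m), ncard_radSet_hyp, ncard_kerSet_hyp,
    ncard_isoSet_stdForm, ncard_radSet_stdForm, ncard_kerSet_stdForm]
  rw [fromRows_mul_fromCols, fromRows_mul, mul_fromCols, mul_fromCols, fromRows_mul]
  rw [hcc, hcd, hdc, hdd]
  ext (i | i | i) (j | j | j) <;> first | exact i.elim | exact j.elim | simp

end Model

/-! ### The representatives in model coordinates -/

section Coordinates

variable {F : Type*} [Field F] {s r m ν : ℕ}

/-- The coordinate function behind `modelEquiv`. -/
def modelIdx (s r m : ℕ) : Fin s ⊕ StdIdx r m → ℕ :=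
  Sum.elim (fun i => i)
    (Sum.elim (Sum.elim (fun k => s + 2 * k) fun k => s + 2 * k + 1) fun j => s + 2 * r + j)

theorem modelIdx_lt (h : s + 2 * r + m = ν) (x : Fin s ⊕ StdIdx r m) : modelIdx s r m x < ν := by
  rcases x with i | (k | k) | j <;> simp only [modelIdx, Sum.elim_inl, Sum.elim_inr] <;> omega

/-- The first `s` coordinates, then `r` adjacent pairs, then `m` further coordinates. -/
noncomputable def modelEquiv (h : s + 2 * r + m = ν) : Fin s ⊕ StdIdx r m ≃ Fin ν :=
  Equiv.ofBijective (fun x => ⟨modelIdx s r m x, modelIdx_lt h x⟩) <| by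
    rw [Fintype.bijective_iff_injective_and_card]
    constructor
    · rintro (i | (k | k) | j) (i' | (k' | k') | j') hij <;>
        simp only [modelIdx, Sum.elim_inl, Sum.elim_inr, Fin.mk.injEq] at hij <;>
        first
        | (exfalso; omega)
        | (congr; ext; omega)
    · simp
      omega

theorem modelEquiv_val (h : s + 2 * r + m = ν) (x : Fin s ⊕ StdIdx r m) :
    (modelEquiv h x).val = modelIdx s r m x := rfl

theorem le_modelIdx_inr (x : StdIdx r m) : s ≤ modelIdx s r m (.inr x) := by
  rcases x with (k | k) | j <;> simp only [modelIdx, Sum.elim_inl, Sum.elim_inr] <;> omega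

theorem E_submatrix_form (h : s + 2 * r + m = ν) {i j : ℕ} (hi : i < s) (hj : j < s) :
    (E F ν ν i j).submatrix (modelEquiv h) (modelEquiv h) = fromBlocks (E F s s i j) 0 0 0 := by
  ext (a | a) (b | b)
  · rfl
  · have := le_modelIdx_inr (s := s) b
    exact if_neg fun h => by have := h.2; rw [modelEquiv_val] at this; omega
  · have := le_modelIdx_inr (s := s) a
    exact if_neg fun h => by have := h.1; rw [modelEquiv_val] at this; omega
  · have := le_modelIdx_inr (s := s) a
    exact if_neg fun h => by have := h.1; rw [modelEquiv_val] at this; omega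

theorem U_submatrix (h : s + 2 * r + m = ν) {i j : ℕ} (hi : i < s) (hj : j < s) :
    (U F ν i j).submatrix (modelEquiv h) (modelEquiv h) = fromBlocks (U F s i j) 0 0 0 := by
  rw [U, submatrix_sub, Pi.sub_apply, Pi.sub_apply, E_submatrix_form h hi hj,
    E_submatrix_form h hj hi, U, sub_eq_add_neg, fromBlocks_neg, fromBlocks_add]
  simp [sub_eq_add_neg]

theorem E_submatrix_cols (h : s + 2 * r + m = ν) {i j : ℕ} (hi : i < s) :
    (E F ν 2 i j).submatrix (modelEquiv h) id = modelCols (E F s 2 i j) r m := by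
  ext (a | a) b
  · rfl
  · have := le_modelIdx_inr (s := s) a
    exact if_neg fun h => by have := h.1; rw [modelEquiv_val] at this; omega

theorem alt_apply (x y : Fin ν) :
    alt F ν s r x y = ∑ k ∈ Finset.range r,
      ((if x.val = s + 2 * k ∧ y.val = s + 2 * k + 1 then (1 : F) else 0) -
        if x.val = s + 2 * k + 1 ∧ y.val = s + 2 * k then 1 else 0) := by
  rw [alt, Matrix.sum_apply]
  rfl

theorem alt_eq_zero {x y : Fin ν}
    (h : ∀ k < r, ¬ (x.val = s + 2 * k ∧ y.val = s + 2 * k + 1) ∧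
      ¬ (x.val = s + 2 * k + 1 ∧ y.val = s + 2 * k)) : alt F ν s r x y = 0 := by
  rw [alt_apply]
  refine Finset.sum_eq_zero fun k hk => ?_
  obtain ⟨h1, h2⟩ := h k (Finset.mem_range.mp hk)
  rw [if_neg h1, if_neg h2, sub_zero]

theorem alt_eq_one {x y : Fin ν} {k : ℕ} (hk : k < r) (hx : x.val = s + 2 * k)
    (hy : y.val = s + 2 * k + 1) : alt F ν s r x y = 1 := by
  rw [alt_apply, Finset.sum_eq_single_of_mem k (Finset.mem_range.mpr hk)]
  · rw [if_pos ⟨hx, hy⟩, if_neg (by omega), sub_zero]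
  · intro l _ hl
    rw [if_neg (by omega), if_neg (by omega), sub_zero]

theorem alt_eq_neg_one {x y : Fin ν} {k : ℕ} (hk : k < r) (hx : x.val = s + 2 * k + 1)
    (hy : y.val = s + 2 * k) : alt F ν s r x y = -1 := by
  rw [alt_apply, Finset.sum_eq_single_of_mem k (Finset.mem_range.mpr hk)]
  · rw [if_neg (by omega), if_pos ⟨hx, hy⟩, zero_sub]
  · intro l _ hl
    rw [if_neg (by omega), if_neg (by omega), sub_zero]

theorem alt_submatrix (h : s + 2 * r + m = ν) :
    (alt F ν s r).submatrix (modelEquiv h) (modelEquiv h) = modelForm 0 r m := by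
  ext x y
  rw [submatrix_apply]
  have hz : (∀ k < r, ¬ (modelIdx s r m x = s + 2 * k ∧ modelIdx s r m y = s + 2 * k + 1) ∧
      ¬ (modelIdx s r m x = s + 2 * k + 1 ∧ modelIdx s r m y = s + 2 * k)) →
      alt F ν s r (modelEquiv h x) (modelEquiv h y) = 0 := fun H =>
    alt_eq_zero (x := modelEquiv h x) (y := modelEquiv h y) H
  rcases x with i | (k | k) | j <;> rcases y with i' | (k' | k') | j' <;>
    simp only [modelIdx, Sum.elim_inl, Sum.elim_inr] at hz
  case inr.inl.inl.inr.inl.inr =>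
    by_cases hk : k = k'
    · subst hk
      rw [alt_eq_one k.2 rfl rfl]
      simp [modelForm, stdForm, J]
    · have hk' : k.val ≠ k'.val := fun h => hk (Fin.ext h)
      rw [hz (by intros; omega)]
      simp [modelForm, stdForm, J, hk]
  case inr.inl.inr.inr.inl.inl =>
    by_cases hk : k = k'
    · subst hk
      rw [alt_eq_neg_one k.2 rfl rfl]
      simp [modelForm, stdForm, J]
    · have hk' : k.val ≠ k'.val := fun h => hk (Fin.ext h)
      rw [hz (by intros; omega)]
      simp [modelForm, stdForm, J, hk]
  all_goals
    rw [hz (by intros; omega)]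
    simp [modelForm, stdForm, J]

/-- `alt` splits off its first block. -/
theorem alt_succ (s r : ℕ) : alt F ν s (r + 1) = U F ν s (s + 1) + alt F ν (s + 2) r := by
  rw [alt, Finset.sum_range_succ', add_comm, alt]
  congr 1
  refine Finset.sum_congr rfl fun k _ => ?_
  congr 1 <;> ring

end Coordinates


/-! ### The plane isometries realized in the stabilizers -/

section Admissible

variable {F : Type*} [Field F]

theorem nonempty_isoSet_model {σ κ : Type*} [Fintype σ] [DecidableEq σ] [Fintype κ]
    {A : Matrix σ σ F} {B : Matrix σ κ F} {D : Matrix κ κ F} {M : Matrix σ σ F}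
    (hM : M ∈ isoSet A B D) (r m : ℕ) :
    (isoSet (modelForm A r m) (modelCols B r m) D).Nonempty := by
  obtain ⟨h1, h2, h3⟩ := hM
  refine ⟨fromBlocks M 0 0 1, ?_, ?_, ?_⟩
  · rw [det_fromBlocks_zero₂₁, det_one, mul_one]
    exact h1
  · simp [modelForm, fromBlocks_transpose, fromBlocks_multiply, h2]
  · rw [modelCols, fromBlocks_mul_fromRows, fromRows_mul]
    simp [h3]

/-- A column `Z k` in the image of `K` is moved by an admissible `D` within the image of `K`. -/
theorem exists_mul_eq_of_mem_isoSet {ι κ μ : Type*} [Fintype ι] [DecidableEq ι] [Fintype κ]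
    {K : Matrix ι ι F} {Z : Matrix ι κ F} {D : Matrix κ κ F} {M : Matrix ι ι F}
    (hM : M ∈ isoSet K Z D) {k : Matrix κ μ F} {u : Matrix ι μ F} (hu : Z * k = K * u) :
    Z * D * k = K * (Mᵀ * u) := by
  obtain ⟨h1, h2, h3⟩ := hM
  have e1 : M * (Z * D * k) = Z * k := by
    rw [← Matrix.mul_assoc, ← Matrix.mul_assoc, h3]
  have e2 : M * (K * (Mᵀ * u)) = Z * k := by
    rw [← Matrix.mul_assoc, ← Matrix.mul_assoc, h2, hu]
  rw [← nonsing_inv_mul_cancel_left M (Z * D * k) h1, e1, ← e2, nonsing_inv_mul_cancel_left M _ h1]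

/-- If the marked functionals are represented by the vectors `U`, then an admissible `D` preserves
the Gram matrix of `U`. -/
theorem transpose_mul_gram_of_mem_isoSet {ι κ : Type*} [Fintype ι] [DecidableEq ι] [Fintype κ]
    [DecidableEq κ] {K : Matrix ι ι F} (hK : Kᵀ = -K) {Z : Matrix ι κ F} {D : Matrix κ κ F}
    {M : Matrix ι ι F} (hM : M ∈ isoSet K Z D) {U : Matrix ι κ F} (hU : Z = K * U) :
    Dᵀ * (Uᵀ * Z) * D = Uᵀ * Z := by
  have h := exists_mul_eq_of_mem_isoSet hM (k := 1) (u := U) (by rw [Matrix.mul_one, hU])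
  rw [Matrix.mul_one] at h
  have hUK : Uᵀ * K = -Zᵀ := by
    rw [hU, transpose_mul, hK, Matrix.mul_neg, neg_neg]
  calc Dᵀ * (Uᵀ * Z) * D = Dᵀ * (Uᵀ * (Z * D)) := by simp only [Matrix.mul_assoc]
    _ = Dᵀ * ((Uᵀ * K) * (Mᵀ * U)) := by rw [h]; simp only [Matrix.mul_assoc]
    _ = -((M * Z * D)ᵀ * U) := by
      rw [hUK]; simp only [transpose_mul, Matrix.mul_assoc, Matrix.neg_mul, Matrix.mul_neg]
    _ = Uᵀ * Z := by rw [hM.2.2, ← Matrix.neg_mul, ← hUK, Matrix.mul_assoc, ← hU]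

theorem modelForm_transpose {σ : Type*} {A : Matrix σ σ F} (hA : Aᵀ = -A) (r m : ℕ) :
    (modelForm A r m)ᵀ = -modelForm A r m := by
  simp [modelForm, fromBlocks_transpose, fromBlocks_neg, hA, stdForm_transpose]

theorem admissible_eq_orthDelta {σ : Type*} [Fintype σ] [DecidableEq σ] {z : F} {A : Matrix σ σ F}
    {B : Matrix σ (Fin 2) F} (h : ∀ D ∈ orthDelta z, (isoSet A B D).Nonempty) (r m : ℕ) :
    admissible z (modelForm A r m) (modelCols B r m) = orthDelta z := by
  ext D
  refine ⟨fun hD => hD.1, fun hD => ⟨hD, ?_⟩⟩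
  obtain ⟨M, hM⟩ := h D hD
  exact nonempty_isoSet_model hM r m

theorem admissible_model_submatrix {σ τ : Type*} [Fintype σ] [DecidableEq σ] [Fintype τ]
    [DecidableEq τ] (ε : τ ≃ σ) (z : F) (A : Matrix σ σ F) (B : Matrix σ (Fin 2) F) (r m : ℕ) :
    admissible z (modelForm (A.submatrix ε ε) r m) (modelCols (B.submatrix ε id) r m) =
      admissible z (modelForm A r m) (modelCols B r m) := by
  rw [← admissible_submatrix (Equiv.sumCongr ε (Equiv.refl (StdIdx r m)))]
  congr 1
  · ext (i | i) (j | j) <;> rfl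
  · ext (i | i) j <;> rfl

theorem nonempty_isoSet_zero {z : F} (hz0 : z ≠ 0) {D : Matrix (Fin 2) (Fin 2) F}
    (hD : D ∈ orthDelta z) : (isoSet (0 : Matrix (Fin 2) (Fin 2) F) 1 D).Nonempty := by
  have hu := isUnit_det_of_mem_orthDelta hz0 hD
  exact ⟨D⁻¹, (isUnit_nonsing_inv_det_iff).mpr hu, by simp, by simp [nonsing_inv_mul _ hu]⟩

/-- On two hyperbolic planes with one marked coordinate each, `D` acts on the marked coordinates,
and contragrediently on the dual ones. -/
theorem nonempty_isoSet_hyp_hyp {z : F} (hz0 : z ≠ 0) {D : Matrix (Fin 2) (Fin 2) F}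
    (hD : D ∈ orthDelta z) :
    (isoSet (fromBlocks 0 1 (-1) 0 : Matrix (Fin 2 ⊕ Fin 2) (Fin 2 ⊕ Fin 2) F)
      (fromRows 1 0 : Matrix (Fin 2 ⊕ Fin 2) (Fin 2) F) D).Nonempty := by
  have hu := isUnit_det_of_mem_orthDelta hz0 hD
  refine ⟨fromBlocks D⁻¹ 0 0 Dᵀ, ?_, ?_, ?_⟩
  · rw [det_fromBlocks_zero₂₁, det_transpose]
    exact ((isUnit_nonsing_inv_det_iff).mpr hu).mul hu
  · have h : Dᵀ * D⁻¹ᵀ = 1 := by rw [← transpose_mul, nonsing_inv_mul _ hu, transpose_one]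
    simp [fromBlocks_transpose, fromBlocks_multiply, nonsing_inv_mul _ hu, h]
  · rw [fromBlocks_mul_fromRows, fromRows_mul]
    simp [nonsing_inv_mul _ hu]

theorem U_transpose {ν : ℕ} (i j : ℕ) : (U F ν i j)ᵀ = -U F ν i j := by
  have h : ∀ i j, (E F ν ν i j)ᵀ = E F ν ν j i := by
    intro i j
    ext k l
    simp [E, and_comm]
  rw [U, transpose_sub, h, h, neg_sub]

theorem U_two_eq : U F 2 0 1 = !![0, 1; -1, 0] := by
  ext i j
  fin_cases i <;> fin_cases j <;> simp [U, E]

theorem mul_U_two_mul_transpose (D : Matrix (Fin 2) (Fin 2) F) :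
    D * U F 2 0 1 * Dᵀ = D.det • U F 2 0 1 := by
  rw [U_two_eq]
  ext i j
  fin_cases i <;> fin_cases j <;>
    simp [Matrix.mul_apply, Fin.sum_univ_two, Matrix.det_fin_two] <;> ring

/-- If the two marked functionals are represented by a nondegenerate plane, exactly the rotations
are admissible. -/
theorem admissible_rotation {z b : F} (hz0 : z ≠ 0) (hb : b ≠ 0) (r m : ℕ) :
    admissible z (modelForm (b • U F 2 0 1) r m)
      (modelCols (1 : Matrix (Fin 2) (Fin 2) F) r m) = {D | D ∈ orthDelta z ∧ D.det = 1} := by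
  ext D
  constructor
  · rintro ⟨hD, M, hM⟩
    refine ⟨hD, ?_⟩
    set W : Matrix (Fin 2 ⊕ StdIdx r m) (Fin 2) F := modelCols (-b⁻¹ • U F 2 0 1) r m with hW
    have hsq : U F 2 0 1 * U F 2 0 1 = -1 := by
      rw [U_two_eq]
      ext i j
      fin_cases i <;> fin_cases j <;> simp
    have hKW : modelCols (1 : Matrix (Fin 2) (Fin 2) F) r m =
        modelForm (b • U F 2 0 1) r m * W := by
      rw [hW, modelForm, modelCols, modelCols, fromBlocks_mul_fromRows]
      simp [hsq, smul_smul, hb]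
    have h := transpose_mul_gram_of_mem_isoSet (modelForm_transpose
      (by rw [transpose_smul, U_transpose, smul_neg]) r m) hM hKW
    have hWZ : Wᵀ * modelCols (1 : Matrix (Fin 2) (Fin 2) F) r m = b⁻¹ • U F 2 0 1 := by
      rw [hW, modelCols, modelCols, transpose_fromRows, fromCols_mul_fromRows]
      simp [U_transpose]
    rw [hWZ, Matrix.mul_smul, Matrix.smul_mul] at h
    have h' := mul_U_two_mul_transpose Dᵀ
    rw [transpose_transpose, det_transpose] at h'
    rw [h'] at h
    have h01 := congrFun (congrFun h 0) 1
    simp [U_two_eq] at h01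
    exact mul_left_cancel₀ (inv_ne_zero hb) (h01.trans (mul_one _).symm)
  · rintro ⟨hD, hdet⟩
    have hu := isUnit_det_of_mem_orthDelta hz0 hD
    refine ⟨hD, nonempty_isoSet_model (M := D⁻¹) ⟨(isUnit_nonsing_inv_det_iff).mpr hu, ?_, ?_⟩ r m⟩
    · rw [Matrix.mul_smul, Matrix.smul_mul, mul_U_two_mul_transpose, det_nonsing_inv, hdet]
      simp
    · simp [nonsing_inv_mul _ hu]

/-- The Klein four-group `{±1, ±R}` with `R` the reflection of parameter `p`. -/
def klein (z : F) (p : F × F) : Set (Matrix (Fin 2) (Fin 2) F) :=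
  {1, -1, deltaMat z p (-1), -deltaMat z p (-1)}

theorem mem_klein_of_eq {z : F} {p p₀ : F × F} (hp : p ∈ conic z) (hp₀ : p₀ ∈ conic z) {t : F}
    (ht : t = 1 ∨ t = -1) (h1 : t = 1 → p.2 = 0) (h2 : t = -1 → p.1 * p₀.2 = p.2 * p₀.1) :
    deltaMat z p t ∈ klein z p₀ := by
  have hp' : p.1 ^ 2 - z * p.2 ^ 2 = 1 := hp
  have hp₀' : p₀.1 ^ 2 - z * p₀.2 ^ 2 = 1 := hp₀
  rcases ht with rfl | rfl
  · have h := h1 rfl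
    have hsq : p.1 * p.1 = 1 := by rw [h] at hp'; linear_combination hp'
    rcases mul_self_eq_one_iff.mp hsq with hx | hx
    · left
      ext i j
      fin_cases i <;> fin_cases j <;> simp [deltaMat, h, hx]
    · right; left
      ext i j
      fin_cases i <;> fin_cases j <;> simp [deltaMat, h, hx]
  · have h := h2 rfl
    -- `p = x p₀` where `x = ±1` is the inner product of `p` and `p₀`
    obtain ⟨x, hx⟩ : ∃ x, x = p.1 * p₀.1 - z * p.2 * p₀.2 := ⟨_, rfl⟩
    have e1 : p.1 = x * p₀.1 := by
      rw [hx]; linear_combination (-p.1) * hp₀' + (-z * p₀.2) * h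
    have e2 : p.2 = x * p₀.2 := by
      rw [hx]; linear_combination (-p.2) * hp₀' - p₀.1 * h
    have hsq : x * x = 1 := by
      rw [e1, e2] at hp'
      linear_combination hp' - x ^ 2 * hp₀'
    rcases mul_self_eq_one_iff.mp hsq with hx | hx
    · right; right; left
      ext i j
      fin_cases i <;> fin_cases j <;> simp [deltaMat, e1, e2, hx]
    · right; right; right
      change _ = -deltaMat z p₀ (-1)
      ext i j
      fin_cases i <;> fin_cases j <;> simp [deltaMat, e1, e2, hx]

theorem klein_subset_orthDelta {z : F} {p₀ : F × F} (hp₀ : p₀ ∈ conic z) :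
    klein z p₀ ⊆ orthDelta z := by
  have hneg : ∀ D ∈ orthDelta z, -D ∈ orthDelta z := by
    intro D hD
    have hD' : D * Δ z * Dᵀ = Δ z := hD
    change -D * Δ z * (-D)ᵀ = Δ z
    simp [hD']
  have h1 : (1 : Matrix (Fin 2) (Fin 2) F) ∈ orthDelta z := by
    change 1 * Δ z * 1ᵀ = Δ z
    simp
  have hR : deltaMat z p₀ (-1) ∈ orthDelta z := deltaMat_mem hp₀ (by ring)
  rintro D (rfl | rfl | rfl | rfl)
  · exact h1
  · exact hneg _ h1
  · exact hR
  · exact hneg _ hR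

/-- One marked functional, entering `Z` with coefficients `(1, a)`: the admissible `D` are those
preserving the line through `(1, a)`. -/
theorem admissible_line {s : ℕ} (hs : 0 < s) {z a : F} (hz0 : z ≠ 0) {p₀ : F × F}
    (hp₀ : p₀ ∈ conic z) (hR : p₀.1 - a * z * p₀.2 = 1) (hR' : p₀.2 - a * p₀.1 = a)
    (h1 : ∀ p : F × F, p ∈ conic z → p.2 + a * p.1 = a * (p.1 + a * z * p.2) → p.2 = 0)
    (h2 : ∀ p : F × F, p ∈ conic z → p.2 - a * p.1 = a * (p.1 - a * z * p.2) →
      p.1 * p₀.2 = p.2 * p₀.1)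
    (A : Matrix (Fin s) (Fin s) F) (r m : ℕ) :
    admissible z (modelForm A r m) (modelCols (colsOne s a) r m) = klein z p₀ := by
  ext D
  constructor
  · rintro ⟨hD, M, hM⟩
    obtain ⟨p, hp, t, ht, rfl⟩ := exists_eq_deltaMat hz0 hD
    set v : Fin 2 → F := ![1, a] with hv
    set c : Fin s ⊕ StdIdx r m → F := Pi.single (.inl ⟨0, hs⟩) 1 with hc
    have hZ : modelCols (colsOne s a) r m = vecMulVec c v := by
      ext (i | i) j
      · by_cases hi : i.val = 0
        · have hi' : i = ⟨0, hs⟩ := Fin.ext hi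
          fin_cases j <;> simp [modelCols, colsOne, E, vecMulVec, c, v, hi']
        · have hi' : i ≠ ⟨0, hs⟩ := fun h => hi (congrArg Fin.val h)
          fin_cases j <;> simp [modelCols, colsOne, E, vecMulVec, c, v, hi, hi']
      · simp [modelCols, vecMulVec, c]
    have h := hM.2.2
    rw [hZ, mul_vecMulVec, vecMulVec_mul] at h
    have e0 := congrFun (congrFun h (.inl ⟨0, hs⟩)) 0
    have e1 := congrFun (congrFun h (.inl ⟨0, hs⟩)) 1
    simp only [vecMulVec, of_apply, c, v, Pi.single_eq_same, deltaMat, vecMul, dotProduct,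
      Fin.sum_univ_two] at e0 e1
    set x := (M *ᵥ Pi.single (Sum.inl ⟨0, hs⟩) 1) (Sum.inl ⟨0, hs⟩)
    simp at e0 e1
    have hrel : p.2 + a * (t * p.1) = a * (p.1 + a * (t * z * p.2)) := by
      linear_combination (p.2 + a * (t * p.1)) * (-e0) + (p.1 + a * (t * z * p.2)) * e1
    refine mem_klein_of_eq hp hp₀ ht ?_ ?_
    · rintro rfl
      exact h1 p hp (by linear_combination hrel)
    · rintro rfl
      exact h2 p hp (by linear_combination hrel)
  · intro hD
    refine ⟨klein_subset_orthDelta hp₀ hD, ?_⟩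
    have hRfix : colsOne s a * deltaMat z p₀ (-1) = colsOne s a := by
      ext i j
      fin_cases j
      · simp [colsOne, E, deltaMat, Matrix.mul_apply, Fin.sum_univ_two]
        by_cases hi : i.val = 0
        · simp [hi]
          linear_combination hR
        · simp [hi]
      · simp [colsOne, E, deltaMat, Matrix.mul_apply, Fin.sum_univ_two]
        by_cases hi : i.val = 0
        · simp [hi]
          linear_combination hR'
        · simp [hi]
    have hneg : IsUnit (-1 : Matrix (Fin s) (Fin s) F).det := by
      rw [← Matrix.isUnit_iff_isUnit_det]
      exact isUnit_one.neg
    rcases hD with rfl | rfl | rfl | rfl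
    · exact nonempty_isoSet_model (M := 1) ⟨by simp, by simp, by simp⟩ r m
    · exact nonempty_isoSet_model (M := -1) ⟨hneg, by simp, by simp⟩ r m
    · exact nonempty_isoSet_model (M := 1) ⟨by simp, by simp, by simp [hRfix]⟩ r m
    · exact nonempty_isoSet_model (M := -1) ⟨hneg, by simp, by simp [hRfix]⟩ r m

/-- Two marked functionals, with a single combination `k` of them represented by a vector: the
admissible `D` are those preserving the line through `k`. -/
theorem admissible_column {z : F} (hz0 : z ≠ 0) {p₀ : F × F} (hp₀ : p₀ ∈ conic z)
    {k : Matrix (Fin 2) (Fin 1) F} {x : F} (hx : x = 1 ∨ x = -1)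
    (hR : deltaMat z p₀ (-1) * k = x • k)
    (h1 : ∀ p : F × F, p ∈ conic z → (∃ y : F, deltaMat z p 1 * k = y • k) → p.2 = 0)
    (h2 : ∀ p : F × F, p ∈ conic z → (∃ y : F, deltaMat z p (-1) * k = y • k) →
      p.1 * p₀.2 = p.2 * p₀.1) (r m : ℕ) :
    admissible z (modelForm (fromBlocks 0 k (-kᵀ) 0) r m)
      (modelCols (fromRows 1 0 : Matrix (Fin 2 ⊕ Fin 1) (Fin 2) F) r m) = klein z p₀ := by
  ext D
  constructor
  · rintro ⟨hD, M, hM⟩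
    have hline : ∃ y : F, D * k = y • k := by
      set W : Matrix ((Fin 2 ⊕ Fin 1) ⊕ StdIdx r m) (Fin 1) F :=
        modelCols (fromRows 0 1) r m with hW
      have hu : modelCols (fromRows 1 0 : Matrix (Fin 2 ⊕ Fin 1) (Fin 2) F) r m * k =
          modelForm (fromBlocks 0 k (-kᵀ) 0) r m * W := by
        rw [hW, modelForm, modelCols, modelCols, fromBlocks_mul_fromRows, fromBlocks_mul_fromRows,
          fromRows_mul, fromRows_mul]
        simp
      have h := exists_mul_eq_of_mem_isoSet hM hu
      set X := Mᵀ * W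
      refine ⟨X (.inl (.inr 0)) 0, ?_⟩
      ext i j
      have hij := congrFun (congrFun h (.inl (.inl i))) j
      have hj : j = 0 := Subsingleton.elim _ _
      subst hj
      rw [Matrix.mul_assoc, modelCols, fromRows_mul, fromRows_mul] at hij
      simp [Matrix.mul_apply, modelForm, Fintype.sum_sum_type] at hij
      simp [Matrix.mul_apply]
      linear_combination hij
    obtain ⟨p, hp, t, ht, rfl⟩ := exists_eq_deltaMat hz0 hD
    refine mem_klein_of_eq hp hp₀ ht ?_ ?_
    · rintro rfl
      exact h1 p hp hline
    · rintro rfl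
      exact h2 p hp hline
  · intro hD
    have hO := klein_subset_orthDelta hp₀ hD
    refine ⟨hO, ?_⟩
    have hDu := isUnit_det_of_mem_orthDelta hz0 hO
    obtain ⟨y, hy, hDk⟩ : ∃ y : F, y * y = 1 ∧ D * k = y • k := by
      rcases hD with rfl | rfl | rfl | rfl
      · exact ⟨1, by ring, by simp⟩
      · exact ⟨-1, by ring, by simp⟩
      · exact ⟨x, by rcases hx with rfl | rfl <;> ring, hR⟩
      · exact ⟨-x, by rcases hx with rfl | rfl <;> ring, by rw [Matrix.neg_mul, hR, neg_smul]⟩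
    have hDk' : D⁻¹ * k = y • k := by
      have : k = y • (D * k) := by rw [hDk, smul_smul, hy, one_smul]
      nth_rewrite 1 [this]
      rw [Matrix.mul_smul, nonsing_inv_mul_cancel_left _ _ hDu]
    have hDkT : kᵀ * D⁻¹ᵀ = y • kᵀ := by rw [← transpose_mul, hDk', transpose_smul]
    have hyu : IsUnit y := IsUnit.of_mul_eq_one y hy
    refine nonempty_isoSet_model (M := fromBlocks D⁻¹ 0 0 (y • 1)) ⟨?_, ?_, ?_⟩ r m
    · rw [det_fromBlocks_zero₂₁]
      refine ((isUnit_nonsing_inv_det_iff).mpr hDu).mul ?_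
      simpa using hyu
    · simp [fromBlocks_transpose, fromBlocks_multiply, hDk', hDkT, smul_smul, hy]
    · rw [fromBlocks_mul_fromRows, fromRows_mul]
      simp [nonsing_inv_mul _ hDu]

end Admissible


/-! ### The representatives -/

section Representatives

variable {F : Type*} [Field F] {s r m ν : ℕ}

theorem altPt_colsOne (z a : F) (K : Matrix (Fin ν) (Fin ν) F) :
    altPt z K (colsOne ν a) = pt (K + diagOne ν z a) (colsOne ν a) := by
  rw [altPt]
  congr 1
  rw [sub_eq_add_neg]
  congr 1
  ext i j
  simp only [diagOne, Δ, colsOne, Matrix.neg_apply, Matrix.smul_apply, Matrix.mul_apply,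
    Fin.sum_univ_two, Matrix.diagonal_apply, E, Matrix.add_apply, Matrix.transpose_apply, of_apply]
  by_cases hi : i.val = 0 <;> by_cases hj : j.val = 0 <;>
    simp [hi, hj, -mul_eq_mul_left_iff, -neg_mul, -mul_eq_mul_right_iff]
  ring_nf

theorem altPt_colsTwo (z : F) (K : Matrix (Fin ν) (Fin ν) F) :
    altPt z K (colsTwo F ν) = pt (K + diagTwo ν z) (colsTwo F ν) := by
  rw [altPt]
  congr 1
  rw [sub_eq_add_neg]
  congr 1
  ext i j
  simp only [diagTwo, Δ, colsTwo, Matrix.neg_apply, Matrix.smul_apply, Matrix.mul_apply,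
    Fin.sum_univ_two, Matrix.diagonal_apply, E, Matrix.add_apply, Matrix.sub_apply,
    Matrix.transpose_apply, of_apply]
  by_cases hi : i.val = 0 <;> by_cases hj : j.val = 0 <;> by_cases hi' : i.val = 1 <;>
    by_cases hj' : j.val = 1 <;> simp_all

theorem colsOne_submatrix (h : s + 2 * r + m = ν) (hs : 0 < s) (a : F) :
    (colsOne ν a).submatrix (modelEquiv h) id = modelCols (colsOne s a) r m := by
  rw [colsOne, submatrix_add, Pi.add_apply, Pi.add_apply, submatrix_smul, Pi.smul_apply,
    Pi.smul_apply, E_submatrix_cols h hs, E_submatrix_cols h hs]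
  ext (i | i) j <;> simp [modelCols, colsOne]

theorem colsTwo_submatrix (h : s + 2 * r + m = ν) (hs : 1 < s) :
    (colsTwo F ν).submatrix (modelEquiv h) id = modelCols (colsTwo F s) r m := by
  rw [colsTwo, submatrix_add, Pi.add_apply, Pi.add_apply, E_submatrix_cols h (by omega),
    E_submatrix_cols h hs]
  ext (i | i) j <;> simp [modelCols, colsTwo]

theorem add_alt_submatrix (h : s + 2 * r + m = ν) {K : Matrix (Fin ν) (Fin ν) F}
    {A : Matrix (Fin s) (Fin s) F}
    (hK : K.submatrix (modelEquiv h) (modelEquiv h) = fromBlocks A 0 0 0) :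
    (K + alt F ν s r).submatrix (modelEquiv h) (modelEquiv h) = modelForm A r m := by
  rw [submatrix_add, Pi.add_apply, Pi.add_apply, hK, alt_submatrix, modelForm, modelForm,
    fromBlocks_add]
  simp

theorem colsOne_ne_zero (hν : 0 < ν) (a : F) : colsOne ν a ≠ 0 := by
  intro h
  have := congrFun (congrFun h ⟨0, hν⟩) 0
  simp [colsOne, E] at this

theorem colsTwo_ne_zero (hν : 0 < ν) : colsTwo F ν ≠ 0 := by
  intro h
  have := congrFun (congrFun h ⟨0, hν⟩) 0
  simp [colsTwo, E] at this

theorem colsTwo_two : colsTwo F 2 = 1 := by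
  ext i j
  fin_cases i <;> fin_cases j <;> simp [colsTwo, E]

theorem cardSp_pos [Finite F] (r : ℕ) : 0 < cardSp F r := Nat.card_pos

theorem cardGL_pos [Finite F] (m : ℕ) : 0 < cardGL F m := Nat.card_pos

/-- The suborbit length in model coordinates. -/
theorem hasSuborbitLength_of_model [Finite F] {z : F} (hz : ¬ IsSquare z) (h2 : (2 : F) ≠ 0)
    (h : s + 2 * r + m = ν) {K : Matrix (Fin ν) (Fin ν) F} {Z : Matrix (Fin ν) (Fin 2) F}
    {A : Matrix (Fin s) (Fin s) F} {B : Matrix (Fin s) (Fin 2) F}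
    (hK : K.submatrix (modelEquiv h) (modelEquiv h) = modelForm A r m)
    (hZ : Z.submatrix (modelEquiv h) id = modelCols B r m) (hA : Aᵀ = -A) (hne : K ≠ 0 ∨ Z ≠ 0)
    {n N : ℕ} (hn : (admissible z (modelForm A r m) (modelCols B r m)).ncard = n)
    (hN : (isoSet (modelForm A r m) (modelCols B r m) 1).ncard = N) {ℓ : ℚ}
    (hℓ : n ≠ 0 → N ≠ 0 → ℓ * (n * N) = 2 * (Nat.card F + 1) * cardGL F ν) :
    HasSuborbitLength z (altPt z K Z) ℓ := by
  have hKalt : Kᵀ = -K := by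
    have e := modelForm_transpose hA r m
    rw [← hK, transpose_submatrix] at e
    ext i j
    have := congrFun (congrFun e ((modelEquiv h).symm i)) ((modelEquiv h).symm j)
    simpa using this
  rw [← hK, ← hZ, admissible_submatrix] at hn
  rw [← hK, ← hZ, ncard_isoSet_submatrix] at hN
  have key := hasSuborbitLength_altPt hz h2 hKalt hne hn hN
  have hz0 : z ≠ 0 := by rintro rfl; exact hz IsSquare.zero
  have hn0 : n ≠ 0 := by
    rw [← hn]
    refine Set.ncard_ne_zero_of_mem (a := 1) ⟨?_, 1, by simp [isoSet]⟩
    change 1 * Δ z * 1ᵀ = Δ z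
    simp
  have hN0 : N ≠ 0 := by
    rw [← hN]
    exact Set.ncard_ne_zero_of_mem (a := 1) (by simp [isoSet])
  convert key using 1
  rw [eq_div_iff (by exact_mod_cast Nat.mul_ne_zero hn0 hN0), hℓ hn0 hN0, ncard_orthDelta hz h2]
  push_cast
  ring

/-! ### Small coordinate changes -/

/-- The coordinates of one hyperbolic plane. -/
noncomputable def hypEquiv : Unit ⊕ Unit ≃ Fin 2 :=
  Equiv.ofBijective (Sum.elim (fun _ => 0) fun _ => 1) (by decide)

/-- One coordinate followed by a hyperbolic plane. -/
noncomputable def unitHypEquiv : Unit ⊕ (Unit ⊕ Unit) ≃ Fin 3 :=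
  Equiv.ofBijective (Sum.elim (fun _ => 0) (Sum.elim (fun _ => 1) fun _ => 2)) (by decide)

/-- Two hyperbolic planes, spanned by the coordinates `0, 2` and `1, 3`. -/
noncomputable def hypHypEquiv : (Unit ⊕ Unit) ⊕ (Unit ⊕ Unit) ≃ Fin 4 :=
  Equiv.ofBijective (Sum.elim (Sum.elim (fun _ => 0) fun _ => 2) (Sum.elim (fun _ => 1) fun _ => 3))
    (by decide)

/-- The two marked coordinates followed by a third one. -/
noncomputable def twoOneEquiv : Fin 2 ⊕ Fin 1 ≃ Fin 3 :=
  Equiv.ofBijective (Sum.elim ![0, 1] fun _ => 2) (by decide)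

/-- The two marked coordinates followed by the two dual ones. -/
noncomputable def twoTwoEquiv : Fin 2 ⊕ Fin 2 ≃ Fin 4 :=
  Equiv.ofBijective (Sum.elim ![0, 1] ![2, 3]) (by decide)

theorem U_submatrix_hypEquiv : (U F 2 0 1).submatrix hypEquiv hypEquiv = hyp F := by
  ext (i | i) (j | j) <;> simp [U, E, hypEquiv, hyp]

theorem U_submatrix_unitHypEquiv :
    (U F 3 1 2).submatrix unitHypEquiv unitHypEquiv = fromBlocks 0 0 0 (hyp F) := by
  ext (i | i | i) (j | j | j) <;> simp [U, E, unitHypEquiv, hyp]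

theorem U_submatrix_hypHypEquiv : (U F 4 0 2 + U F 4 1 3).submatrix hypHypEquiv hypHypEquiv =
    fromBlocks (hyp F) 0 0 (hyp F) := by
  ext ((i | i) | (i | i)) ((j | j) | (j | j)) <;> simp [U, E, hypHypEquiv, hyp]

theorem U_submatrix_twoOneEquiv : (U F 3 1 2).submatrix twoOneEquiv twoOneEquiv =
    fromBlocks 0 !![0; 1] (-(!![0; 1] : Matrix (Fin 2) (Fin 1) F)ᵀ) 0 := by
  ext (i | i) (j | j) <;> fin_cases i <;> fin_cases j <;> simp [U, E, twoOneEquiv]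

theorem U_add_U_submatrix_twoOneEquiv :
    (U F 3 0 2 + U F 3 1 2).submatrix twoOneEquiv twoOneEquiv =
      fromBlocks 0 !![1; 1] (-(!![1; 1] : Matrix (Fin 2) (Fin 1) F)ᵀ) 0 := by
  ext (i | i) (j | j) <;> fin_cases i <;> fin_cases j <;> simp [U, E, twoOneEquiv]

theorem U_add_U_submatrix_twoTwoEquiv :
    (U F 4 0 2 + U F 4 1 3).submatrix twoTwoEquiv twoTwoEquiv = fromBlocks 0 1 (-1) 0 := by
  ext (i | i) (j | j) <;> fin_cases i <;> fin_cases j <;> simp [U, E, twoTwoEquiv]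

theorem colsTwo_submatrix_twoOneEquiv :
    (colsTwo F 3).submatrix twoOneEquiv id = fromRows 1 0 := by
  ext (i | i) j <;> fin_cases i <;> fin_cases j <;> simp [colsTwo, E, twoOneEquiv]

theorem colsTwo_submatrix_twoTwoEquiv :
    (colsTwo F 4).submatrix twoTwoEquiv id = fromRows 1 0 := by
  ext (i | i) j <;> fin_cases i <;> fin_cases j <;> simp [colsTwo, E, twoTwoEquiv]

theorem colsOne_submatrix_hypEquiv (a : F) :
    (colsOne 2 a).submatrix hypEquiv id = fromRows (of fun _ => ![1, a]) 0 := by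
  ext (i | i) j <;> fin_cases j <;> simp [colsOne, E, hypEquiv]

theorem colsTwo_submatrix_unitHypEquiv : (colsTwo F 3).submatrix unitHypEquiv id =
    fromRows (of fun _ => ![1, 0]) (fromRows (of fun _ => ![0, 1]) 0) := by
  ext (i | i | i) j <;> fin_cases j <;> simp [colsTwo, E, unitHypEquiv]

theorem colsTwo_submatrix_hypHypEquiv : (colsTwo F 4).submatrix hypHypEquiv id =
    fromRows (fromRows (of fun _ => ![1, 0]) 0) (fromRows (of fun _ => ![0, 1]) 0) := by
  ext ((i | i) | (i | i)) j <;> fin_cases j <;> simp [colsTwo, E, hypHypEquiv]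

/-! ### Automorphism counts of the representatives -/

theorem ncard_isoSet_hyp_colsOne (h2 : (2 : F) ≠ 0) (a : F) (r m : ℕ) :
    (isoSet (modelForm (U F 2 0 1) r m) (modelCols (colsOne 2 a) r m) 1).ncard =
      Nat.card F * Nat.card F ^ (2 * r + m) *
        (Nat.card F ^ m * (cardSp F r * (Nat.card F ^ (2 * r * m) * cardGL F m))) := by
  rw [← ncard_isoSet_model_submatrix hypEquiv, U_submatrix_hypEquiv, colsOne_submatrix_hypEquiv]
  refine ncard_isoSet_model_hyp h2 rfl (c' := of fun i _ => ![1, 0] i) ?_ r m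
  ext i j
  simp [Matrix.mul_apply, Fin.sum_univ_two]

theorem ncard_isoSet_three (h2 : (2 : F) ≠ 0) (r m : ℕ) :
    (isoSet (modelForm (U F 3 1 2) r m) (modelCols (colsTwo F 3) r m) 1).ncard =
      Nat.card F ^ m * (Nat.card F * Nat.card F ^ (2 * r + m) *
        (Nat.card F ^ m * (cardSp F r * (Nat.card F ^ (2 * r * m) * cardGL F m)))) := by
  rw [← ncard_isoSet_model_submatrix unitHypEquiv, U_submatrix_unitHypEquiv,
    colsTwo_submatrix_unitHypEquiv]
  refine ncard_isoSet_model_unit_hyp h2 rfl (c' := of fun i _ => ![1, 0] i)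
    (d' := of fun i _ => ![0, 1] i) ?_ ?_ ?_ ?_ r m <;>
  · ext i j
    simp [Matrix.mul_apply, Fin.sum_univ_two]

/-- Replacing the basis vector `e₀` by `e₀ - e₁`, which lies in the radical, turns the form into
`U F 3 1 2`; the row of the marked columns at the new radical vector is then `(1, -1)`. -/
theorem ncard_isoSet_three' (h2 : (2 : F) ≠ 0) (r m : ℕ) :
    (isoSet (modelForm (U F 3 0 2 + U F 3 1 2) r m) (modelCols (colsTwo F 3) r m) 1).ncard =
      Nat.card F ^ m * (Nat.card F * Nat.card F ^ (2 * r + m) *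
        (Nat.card F ^ m * (cardSp F r * (Nat.card F ^ (2 * r * m) * cardGL F m)))) := by
  set P₃ : Matrix (Fin 3) (Fin 3) F := !![1, -1, 0; 0, 1, 0; 0, 0, 1] with hP
  set Q₃ : Matrix (Fin 3) (Fin 3) F := !![1, 1, 0; 0, 1, 0; 0, 0, 1] with hQ
  have hPQ : P₃ * Q₃ = 1 := by
    ext i j
    fin_cases i <;> fin_cases j <;> simp [hP, hQ, Matrix.mul_apply, Fin.sum_univ_three]
  have hQP : Q₃ * P₃ = 1 := by
    ext i j
    fin_cases i <;> fin_cases j <;> simp [hP, hQ, Matrix.mul_apply, Fin.sum_univ_three]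
  have hform : P₃ * (U F 3 0 2 + U F 3 1 2) * P₃ᵀ = U F 3 1 2 := by
    have hY : U F 3 0 2 + U F 3 1 2 = !![0, 0, 1; 0, 0, 1; -1, -1, 0] := by
      ext i j
      fin_cases i <;> fin_cases j <;> simp [U, E]
    have hU : U F 3 1 2 = !![0, 0, 0; 0, 0, 1; 0, -1, 0] := by
      ext i j
      fin_cases i <;> fin_cases j <;> simp [U, E]
    rw [hY, hU]
    ext i j
    fin_cases i <;> fin_cases j <;> simp [hP, Matrix.mul_apply, Fin.sum_univ_three]
  have hcols : (P₃ * colsTwo F 3).submatrix unitHypEquiv id =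
      fromRows (of fun _ => ![1, -1]) (fromRows (of fun _ => ![0, 1]) 0) := by
    have hC : colsTwo F 3 = !![1, 0; 0, 1; 0, 0] := by
      ext i j
      fin_cases i <;> fin_cases j <;> simp [colsTwo, E]
    rw [hC]
    ext (i | i | i) j <;> fin_cases j <;>
      simp [hP, unitHypEquiv]
  have hPQ' : (fromBlocks P₃ 0 0 1 : Matrix (Fin 3 ⊕ StdIdx r m) (Fin 3 ⊕ StdIdx r m) F) *
      fromBlocks Q₃ 0 0 1 = 1 := by
    simp [fromBlocks_multiply, hPQ]
  have hQP' : (fromBlocks Q₃ 0 0 1 : Matrix (Fin 3 ⊕ StdIdx r m) (Fin 3 ⊕ StdIdx r m) F) *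
      fromBlocks P₃ 0 0 1 = 1 := by
    simp [fromBlocks_multiply, hQP]
  have e1 : fromBlocks P₃ 0 0 1 * modelForm (U F 3 0 2 + U F 3 1 2) r m * (fromBlocks P₃ 0 0 1)ᵀ =
      modelForm (U F 3 1 2) r m := by
    simp [modelForm, fromBlocks_multiply, fromBlocks_transpose, hform]
  have e2 : (fromBlocks P₃ 0 0 1 : Matrix (Fin 3 ⊕ StdIdx r m) (Fin 3 ⊕ StdIdx r m) F) *
      modelCols (colsTwo F 3) r m = modelCols (P₃ * colsTwo F 3) r m := by
    rw [modelCols, modelCols, fromBlocks_mul_fromRows]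
    simp
  rw [← ncard_isoSet_conj hPQ' hQP', e1, e2, ← ncard_isoSet_model_submatrix unitHypEquiv,
    U_submatrix_unitHypEquiv, hcols]
  refine ncard_isoSet_model_unit_hyp h2 rfl (c' := of fun i _ => ![1, 0] i)
    (d' := of fun i _ => ![1, 1] i) ?_ ?_ ?_ ?_ r m <;>
  · ext i j
    simp [Matrix.mul_apply, Fin.sum_univ_two]

theorem ncard_isoSet_four (h2 : (2 : F) ≠ 0) (r m : ℕ) :
    (isoSet (modelForm (U F 4 0 2 + U F 4 1 3) r m) (modelCols (colsTwo F 4) r m) 1).ncard =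
      Nat.card F * (Nat.card F * Nat.card F ^ (2 * r + m)) * (Nat.card F ^ m *
      (Nat.card F * Nat.card F ^ (2 * r + m) *
        (Nat.card F ^ m * (cardSp F r * (Nat.card F ^ (2 * r * m) * cardGL F m))))) := by
  rw [← ncard_isoSet_model_submatrix hypHypEquiv, U_submatrix_hypHypEquiv,
    colsTwo_submatrix_hypHypEquiv]
  refine ncard_isoSet_model_hyp_hyp h2 rfl (c' := of fun i _ => ![1, 0] i)
    (d' := of fun i _ => ![0, 1] i) ?_ ?_ ?_ ?_ r m <;>
  · ext i j
    simp [Matrix.mul_apply, Fin.sum_univ_two]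

/-! ### Admissible isometries of the representatives -/

variable {z : F}

theorem ncard_admissible_colsOne {s : ℕ} (hs : 0 < s) (hz : ¬ IsSquare z) (h2 : (2 : F) ≠ 0) {a : F}
    (ha : a = 0 ∨ a = 1) (A : Matrix (Fin s) (Fin s) F) (r m : ℕ) :
    (admissible z (modelForm A r m) (modelCols (colsOne s a) r m)).ncard = 4 := by
  have hz0 : z ≠ 0 := by rintro rfl; exact hz IsSquare.zero
  have hz1' : 1 - z ≠ 0 := fun h => hz ⟨1, by linear_combination -h⟩
  rcases ha with rfl | rfl
  · have hp₀ : ((1, 0) : F × F) ∈ conic z := by simp [conic]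
    rw [admissible_line hs hz0 hp₀ (by simp) (by simp) (fun p _ h => by simpa using h)
      (fun p _ h => by simpa [eq_comm] using h), klein, ncard_klein h2 hp₀]
  · have hp₀ : (((1 + z) / (1 - z), 2 / (1 - z)) : F × F) ∈ conic z := by
      change ((1 + z) / (1 - z)) ^ 2 - z * (2 / (1 - z)) ^ 2 = 1
      field_simp
      ring
    rw [admissible_line hs hz0 hp₀ ?_ ?_ ?_ ?_, klein, ncard_klein h2 hp₀]
    · field_simp
      ring
    · field_simp
      ring
    · intro p _ h
      have : (1 - z) * p.2 = 0 := by linear_combination h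
      exact (mul_eq_zero.mp this).resolve_left hz1'
    · intro p _ h
      field_simp
      linear_combination -h

theorem exists_smul_column {D : Matrix (Fin 2) (Fin 2) F} {c₀ c₁ : F}
    (h : ∃ y : F, D * (!![c₀; c₁] : Matrix (Fin 2) (Fin 1) F) = y • !![c₀; c₁]) :
    (D 0 0 * c₀ + D 0 1 * c₁) * c₁ = (D 1 0 * c₀ + D 1 1 * c₁) * c₀ := by
  obtain ⟨y, hy⟩ := h
  have e0 := congrFun (congrFun hy 0) 0
  have e1 := congrFun (congrFun hy 1) 0
  simp [Matrix.mul_apply, Fin.sum_univ_two] at e0 e1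
  rw [e0, e1]
  ring

theorem ncard_admissible_three (hz : ¬ IsSquare z) (h2 : (2 : F) ≠ 0) (r m : ℕ) :
    (admissible z (modelForm (U F 3 1 2) r m) (modelCols (colsTwo F 3) r m)).ncard = 4 := by
  have hz0 : z ≠ 0 := by rintro rfl; exact hz IsSquare.zero
  have hp₀ : ((1, 0) : F × F) ∈ conic z := by simp [conic]
  rw [← admissible_model_submatrix twoOneEquiv, U_submatrix_twoOneEquiv,
    colsTwo_submatrix_twoOneEquiv, admissible_column hz0 hp₀ (x := -1) (Or.inr rfl) ?_ ?_ ?_, klein,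
    ncard_klein h2 hp₀]
  · ext i j
    fin_cases i <;> fin_cases j <;> simp [deltaMat]
  · intro p _ h
    simpa [deltaMat] using exists_smul_column h
  · intro p _ h
    simpa [deltaMat, eq_comm] using exists_smul_column h

theorem ncard_admissible_three' (hz : ¬ IsSquare z) (h2 : (2 : F) ≠ 0)
    (r m : ℕ) :
    (admissible z (modelForm (U F 3 0 2 + U F 3 1 2) r m)
      (modelCols (colsTwo F 3) r m)).ncard = 4 := by
  have hz0 : z ≠ 0 := by rintro rfl; exact hz IsSquare.zero
  have hz1' : 1 - z ≠ 0 := fun h => hz ⟨1, by linear_combination -h⟩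
  have hp₀ : ((-(1 + z) / (1 - z), 2 / (1 - z)) : F × F) ∈ conic z := by
    change (-(1 + z) / (1 - z)) ^ 2 - z * (2 / (1 - z)) ^ 2 = 1
    field_simp
    ring
  rw [← admissible_model_submatrix twoOneEquiv, U_add_U_submatrix_twoOneEquiv,
    colsTwo_submatrix_twoOneEquiv, admissible_column hz0 hp₀ (x := 1) (Or.inl rfl) ?_ ?_ ?_, klein,
    ncard_klein h2 hp₀]
  · ext i j
    fin_cases i <;> fin_cases j <;> simp [deltaMat, Matrix.mul_apply, Fin.sum_univ_two] <;>
      field_simp <;> ring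
  · intro p _ h
    have e := exists_smul_column h
    simp [deltaMat] at e
    have : (1 - z) * p.2 = 0 := by linear_combination e
    exact (mul_eq_zero.mp this).resolve_left hz1'
  · intro p _ h
    have e := exists_smul_column h
    simp [deltaMat] at e
    field_simp
    linear_combination e

theorem admissible_four (hz : ¬ IsSquare z) (r m : ℕ) :
    admissible z (modelForm (U F 4 0 2 + U F 4 1 3) r m) (modelCols (colsTwo F 4) r m) =
      orthDelta z := by
  have hz0 : z ≠ 0 := by rintro rfl; exact hz IsSquare.zero
  rw [← admissible_model_submatrix twoTwoEquiv, U_add_U_submatrix_twoTwoEquiv,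
    colsTwo_submatrix_twoTwoEquiv]
  exact admissible_eq_orthDelta (fun D hD => nonempty_isoSet_hyp_hyp hz0 hD) r m

/-! ### Lengths of the suborbits -/

theorem two_ne_zero_of_odd_card [Fintype F] (h : Odd (Fintype.card F)) : (2 : F) ≠ 0 := by
  intro h2
  have h0 : (Fintype.card F : F) = 0 := Nat.cast_card_eq_zero F
  obtain ⟨k, hk⟩ := h
  rw [hk] at h0
  push_cast at h0
  rw [h2, zero_mul, zero_add] at h0
  exact one_ne_zero h0

section Lengths

variable [Finite F]

theorem length_φ₁ (hz : ¬ IsSquare z) (h2 : (2 : F) ≠ 0) (hr : 1 ≤ r) (hν : 2 * r + m = ν) :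
    HasSuborbitLength z (φ₁ F ν r) ((cardGL F ν : ℚ) /
      (cardSp F r * cardGL F m * (Nat.card F : ℚ) ^ (2 * r * m))) := by
  have h : 0 + 2 * r + m = ν := by omega
  have e : φ₁ F ν r = altPt z (alt F ν 0 r) 0 := by simp [φ₁, altPt]
  have hq : (Nat.card F : ℚ) ≠ 0 := by exact_mod_cast Nat.card_pos.ne'
  have hs : (cardSp F r : ℚ) ≠ 0 := by exact_mod_cast (cardSp_pos r).ne'
  have hg : (cardGL F m : ℚ) ≠ 0 := by exact_mod_cast (cardGL_pos m).ne'
  have hne : alt F ν 0 r ≠ 0 := by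
    intro h0
    have h1 := alt_eq_one (F := F) (s := 0) (r := r) (x := (⟨0, by omega⟩ : Fin ν))
      (y := ⟨1, by omega⟩) (k := 0) (by omega) rfl rfl
    rw [h0] at h1
    exact zero_ne_one h1
  rw [e]
  refine hasSuborbitLength_of_model hz h2 h (A := 0) (B := 0) (alt_submatrix h) ?_ (by simp)
    (Or.inl hne) (n := 2 * (Nat.card F + 1)) ?_
    (ncard_isoSet_model_marked 0 (B' := 0) (Subsingleton.elim _ _) r m) ?_
  · ext (i | i) j <;> rfl
  · rw [admissible_eq_orthDelta, ncard_orthDelta hz h2]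
    exact fun D hD => ⟨1, by simp [isoSet]⟩
  · intro _ _
    push_cast
    field_simp
    simp

theorem length_φ₂ (hz : ¬ IsSquare z) (h2 : (2 : F) ≠ 0) {a : F}
    (ha : a = 0 ∨ a = 1) (hν : 1 + 2 * r + m = ν) :
    HasSuborbitLength z (φ₂ ν z r a) (((Nat.card F : ℚ) + 1) * cardGL F ν /
      (cardSp F r * cardGL F m * (2 * (Nat.card F : ℚ) ^ ((2 * r + 1) * m)))) := by
  have hq : (Nat.card F : ℚ) ≠ 0 := by exact_mod_cast Nat.card_pos.ne'
  have hs : (cardSp F r : ℚ) ≠ 0 := by exact_mod_cast (cardSp_pos r).ne'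
  have hg : (cardGL F m : ℚ) ≠ 0 := by exact_mod_cast (cardGL_pos m).ne'
  rw [φ₂, ← altPt_colsOne]
  refine hasSuborbitLength_of_model hz h2 hν (A := 0) (alt_submatrix hν)
    (colsOne_submatrix hν one_pos a) (by simp) (Or.inr (colsOne_ne_zero (by omega) a))
    (ncard_admissible_colsOne one_pos hz h2 ha 0 r m)
    (ncard_isoSet_model_marked 0 (B' := !![1; 0]) ?_ r m) ?_
  · ext i j
    fin_cases i
    fin_cases j
    simp [colsOne, E, Matrix.mul_apply, Fin.sum_univ_two]
  · intro _ _
    push_cast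
    field_simp
    simp only [Fintype.card_fin]
    ring

theorem length_φ₃ (hz : ¬ IsSquare z) (h2 : (2 : F) ≠ 0) {a : F}
    (ha : a = 0 ∨ a = 1) (hν : 2 + 2 * r + m = ν) :
    HasSuborbitLength z (φ₃ ν z (r + 1) a) (((Nat.card F : ℚ) + 1) * cardGL F ν /
      (cardSp F r * cardGL F m * (2 * (Nat.card F : ℚ) ^ (2 * (r + 1) * m + (2 * r + 1))))) := by
  have hq : (Nat.card F : ℚ) ≠ 0 := by exact_mod_cast Nat.card_pos.ne'
  have hs : (cardSp F r : ℚ) ≠ 0 := by exact_mod_cast (cardSp_pos r).ne'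
  have hg : (cardGL F m : ℚ) ≠ 0 := by exact_mod_cast (cardGL_pos m).ne'
  rw [φ₃, ← altPt_colsOne, alt_succ]
  refine hasSuborbitLength_of_model hz h2 hν
    (add_alt_submatrix hν (U_submatrix hν (by omega) (by omega)))
    (colsOne_submatrix hν two_pos a) (U_transpose _ _) (Or.inr (colsOne_ne_zero (by omega) a))
    (ncard_admissible_colsOne two_pos hz h2 ha _ r m) (ncard_isoSet_hyp_colsOne h2 a r m) ?_
  intro _ _
  push_cast
  field_simp
  ring

theorem length_φ₄ (hz : ¬ IsSquare z) (h2 : (2 : F) ≠ 0) (hν : 3 + 2 * r + m = ν) :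
    HasSuborbitLength z (φ₄ ν z (r + 1)) (((Nat.card F : ℚ) + 1) * cardGL F ν /
      (cardSp F r * cardGL F m * (2 * (Nat.card F : ℚ) ^ ((2 * r + 3) * m + (2 * r + 1))))) := by
  have hq : (Nat.card F : ℚ) ≠ 0 := by exact_mod_cast Nat.card_pos.ne'
  have hs : (cardSp F r : ℚ) ≠ 0 := by exact_mod_cast (cardSp_pos r).ne'
  have hg : (cardGL F m : ℚ) ≠ 0 := by exact_mod_cast (cardGL_pos m).ne'
  rw [φ₄, ← altPt_colsTwo, alt_succ]
  refine hasSuborbitLength_of_model hz h2 hν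
    (add_alt_submatrix hν (U_submatrix hν (by omega) (by omega)))
    (colsTwo_submatrix hν (by omega)) (U_transpose _ _) (Or.inr (colsTwo_ne_zero (by omega)))
    (ncard_admissible_three hz h2 r m) (ncard_isoSet_three h2 r m) ?_
  intro _ _
  push_cast
  field_simp
  ring

theorem length_φ₅ (hz : ¬ IsSquare z) (h2 : (2 : F) ≠ 0)
    (hν : 3 + 2 * r + m = ν) :
    HasSuborbitLength z (φ₅ ν z (r + 1)) (((Nat.card F : ℚ) + 1) * cardGL F ν /
      (cardSp F r * cardGL F m * (2 * (Nat.card F : ℚ) ^ ((2 * r + 3) * m + (2 * r + 1))))) := by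
  have hq : (Nat.card F : ℚ) ≠ 0 := by exact_mod_cast Nat.card_pos.ne'
  have hs : (cardSp F r : ℚ) ≠ 0 := by exact_mod_cast (cardSp_pos r).ne'
  have hg : (cardGL F m : ℚ) ≠ 0 := by exact_mod_cast (cardGL_pos m).ne'
  rw [φ₅, ← altPt_colsTwo, Nat.add_sub_cancel]
  have hsub : (U F ν 0 2 + U F ν 1 2).submatrix (modelEquiv hν) (modelEquiv hν) =
      fromBlocks (U F 3 0 2 + U F 3 1 2) 0 0 0 := by
    rw [submatrix_add, Pi.add_apply, Pi.add_apply, U_submatrix hν (by omega) (by omega),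
      U_submatrix hν (by omega) (by omega), fromBlocks_add]
    simp
  refine hasSuborbitLength_of_model hz h2 hν (add_alt_submatrix hν hsub)
    (colsTwo_submatrix hν (by omega))
    (by rw [transpose_add, U_transpose, U_transpose, neg_add])
    (Or.inr (colsTwo_ne_zero (by omega)))
    (ncard_admissible_three' hz h2 r m) (ncard_isoSet_three' h2 r m) ?_
  intro _ _
  push_cast
  field_simp
  ring

/-- Also valid for `r = 0`, where `φ₆` and `φ₄` agree. -/
theorem length_φ₆ (hz : ¬ IsSquare z) (h2 : (2 : F) ≠ 0) (hν : 2 + 2 * r + m = ν) :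
    HasSuborbitLength z (φ₆ ν z r) ((cardGL F ν : ℚ) /
      (cardSp F r * cardGL F m * (Nat.card F : ℚ) ^ ((2 * r + 2) * m))) := by
  have hz0 : z ≠ 0 := by rintro rfl; exact hz IsSquare.zero
  have hq : (Nat.card F : ℚ) ≠ 0 := by exact_mod_cast Nat.card_pos.ne'
  have hs : (cardSp F r : ℚ) ≠ 0 := by exact_mod_cast (cardSp_pos r).ne'
  have hg : (cardGL F m : ℚ) ≠ 0 := by exact_mod_cast (cardGL_pos m).ne'
  rw [φ₆, ← altPt_colsTwo]
  refine hasSuborbitLength_of_model hz h2 hν (A := 0) (alt_submatrix hν)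
    (colsTwo_submatrix hν (by omega)) (by simp) (Or.inr (colsTwo_ne_zero (by omega)))
    (n := 2 * (Nat.card F + 1)) ?_ (ncard_isoSet_model_marked 0 (B' := 1) ?_ r m) ?_
  · rw [colsTwo_two, admissible_eq_orthDelta (fun D hD => nonempty_isoSet_zero hz0 hD),
      ncard_orthDelta hz h2]
  · rw [colsTwo_two, Matrix.one_mul]
  · intro _ _
    push_cast
    field_simp
    simp only [Fintype.card_fin]
    ring

theorem length_φ₇ (hz : ¬ IsSquare z) (h2 : (2 : F) ≠ 0) {b : F} (hb : b ≠ 0)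
    (hν : 2 + 2 * r + m = ν) :
    HasSuborbitLength z (φ₇ ν z (r + 1) b) (2 * (cardGL F ν : ℚ) /
      (cardSp F r * cardGL F m * (Nat.card F : ℚ) ^ (2 * (r + 1) * m))) := by
  have hz0 : z ≠ 0 := by rintro rfl; exact hz IsSquare.zero
  have hq : (Nat.card F : ℚ) ≠ 0 := by exact_mod_cast Nat.card_pos.ne'
  have hs : (cardSp F r : ℚ) ≠ 0 := by exact_mod_cast (cardSp_pos r).ne'
  have hg : (cardGL F m : ℚ) ≠ 0 := by exact_mod_cast (cardGL_pos m).ne'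
  rw [φ₇, ← altPt_colsTwo, Nat.add_sub_cancel]
  have hsub : (b • U F ν 0 1).submatrix (modelEquiv hν) (modelEquiv hν) =
      fromBlocks (b • U F 2 0 1) 0 0 0 := by
    rw [submatrix_smul, Pi.smul_apply, Pi.smul_apply, U_submatrix hν (by omega) (by omega),
      fromBlocks_smul]
    simp
  refine hasSuborbitLength_of_model hz h2 hν (add_alt_submatrix hν hsub)
    (colsTwo_submatrix hν (by omega)) (by rw [transpose_smul, U_transpose, smul_neg])
    (Or.inr (colsTwo_ne_zero (by omega)))
    (n := Nat.card F + 1) ?_ (ncard_isoSet_model_marked _ (B' := 1) ?_ r m) ?_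
  · rw [colsTwo_two, admissible_rotation hz0 hb, ncard_orthDelta_det_one hz h2]
  · rw [colsTwo_two, Matrix.one_mul]
  · intro _ _
    push_cast
    field_simp
    simp only [Fintype.card_fin]
    ring

theorem length_φ₈ (hz : ¬ IsSquare z) (h2 : (2 : F) ≠ 0) (hν : 4 + 2 * r + m = ν) :
    HasSuborbitLength z (φ₈ ν z (r + 2)) ((cardGL F ν : ℚ) /
      (cardSp F r * cardGL F m * (Nat.card F : ℚ) ^ (2 * (r + 2) * m + (4 * r + 3)))) := by
  have hq : (Nat.card F : ℚ) ≠ 0 := by exact_mod_cast Nat.card_pos.ne'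
  have hs : (cardSp F r : ℚ) ≠ 0 := by exact_mod_cast (cardSp_pos r).ne'
  have hg : (cardGL F m : ℚ) ≠ 0 := by exact_mod_cast (cardGL_pos m).ne'
  rw [φ₈, ← altPt_colsTwo, Nat.add_sub_cancel]
  have hsub : (U F ν 0 2 + U F ν 1 3).submatrix (modelEquiv hν) (modelEquiv hν) =
      fromBlocks (U F 4 0 2 + U F 4 1 3) 0 0 0 := by
    rw [submatrix_add, Pi.add_apply, Pi.add_apply, U_submatrix hν (by omega) (by omega),
      U_submatrix hν (by omega) (by omega), fromBlocks_add]
    simp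
  refine hasSuborbitLength_of_model hz h2 hν (add_alt_submatrix hν hsub)
    (colsTwo_submatrix hν (by omega))
    (by rw [transpose_add, U_transpose, U_transpose, neg_add])
    (Or.inr (colsTwo_ne_zero (by omega)))
    (n := 2 * (Nat.card F + 1)) ?_ (ncard_isoSet_four h2 r m) ?_
  · rw [admissible_four hz, ncard_orthDelta hz h2]
  · intro _ _
    push_cast
    field_simp
    ring

theorem cardSp_zero : cardSp F 0 = 1 := by
  rw [cardSp]
  have : Subsingleton (symplecticGroup (Fin 0) F) := inferInstance
  exact Nat.card_unique

end Lengths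

end Representatives

end OrthSuborbit

theorem theorem2p5 {F : Type*} [Field F] [Fintype F] (q : ℕ) (hq : Fintype.card F = q)
    (hodd : Odd q) (z : F) (hz : ¬ IsSquare z) (hz1 : ¬ IsSquare (1 - z))
    (Ω : Set F) (hΩ : ∀ x : F, x ≠ 0 ↔ x ∈ Ω ∨ -x ∈ Ω) (ν : ℕ) :
    (∀ r : ℕ, 1 ≤ r → 2 * r ≤ ν →
      OrthSuborbit.HasSuborbitLength z (OrthSuborbit.φ₁ F ν r)
        ((OrthSuborbit.cardGL F ν : ℚ) /
          (OrthSuborbit.cardSp F r * OrthSuborbit.cardGL F (ν - 2 * r) *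
            (q : ℚ) ^ (2 * r * (ν - 2 * r))))) ∧
    (∀ r : ℕ, ∀ a : F, 2 * r + 1 ≤ ν → a = 0 ∨ a = 1 →
      OrthSuborbit.HasSuborbitLength z (OrthSuborbit.φ₂ ν z r a)
        (((q : ℚ) + 1) * OrthSuborbit.cardGL F ν /
          (OrthSuborbit.cardSp F r * OrthSuborbit.cardGL F (ν - 2 * r - 1) *
            (2 * (q : ℚ) ^ ((2 * r + 1) * (ν - 2 * r - 1)))))) ∧
    (∀ r : ℕ, ∀ a : F, 1 ≤ r → 2 * r ≤ ν → a = 0 ∨ a = 1 →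
      OrthSuborbit.HasSuborbitLength z (OrthSuborbit.φ₃ ν z r a)
        (((q : ℚ) + 1) * OrthSuborbit.cardGL F ν /
          (OrthSuborbit.cardSp F (r - 1) * OrthSuborbit.cardGL F (ν - 2 * r) *
            (2 * (q : ℚ) ^ (2 * r * (ν - 2 * r) + 2 * r - 1))))) ∧
    (∀ r : ℕ, 1 ≤ r → 2 * r + 1 ≤ ν →
      OrthSuborbit.HasSuborbitLength z (OrthSuborbit.φ₄ ν z r)
        (((q : ℚ) + 1) * OrthSuborbit.cardGL F ν /
          (OrthSuborbit.cardSp F (r - 1) * OrthSuborbit.cardGL F (ν - 2 * r - 1) *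
            (2 * (q : ℚ) ^ ((2 * r + 1) * (ν - 2 * r) - 2))))) ∧
    (2 ≤ ν →
      OrthSuborbit.HasSuborbitLength z (OrthSuborbit.φ₄ ν z 0)
        ((OrthSuborbit.cardGL F ν : ℚ) /
          (OrthSuborbit.cardGL F (ν - 2) * (q : ℚ) ^ (2 * (ν - 2))))) ∧
    (∀ r : ℕ, 1 ≤ r → 2 * r + 1 ≤ ν →
      OrthSuborbit.HasSuborbitLength z (OrthSuborbit.φ₅ ν z r)
        (((q : ℚ) + 1) * OrthSuborbit.cardGL F ν /
          (OrthSuborbit.cardSp F (r - 1) * OrthSuborbit.cardGL F (ν - 2 * r - 1) *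
            (2 * (q : ℚ) ^ ((2 * r + 1) * (ν - 2 * r) - 2))))) ∧
    (∀ r : ℕ, 1 ≤ r → 2 * r + 2 ≤ ν →
      OrthSuborbit.HasSuborbitLength z (OrthSuborbit.φ₆ ν z r)
        ((OrthSuborbit.cardGL F ν : ℚ) /
          (OrthSuborbit.cardSp F r * OrthSuborbit.cardGL F (ν - 2 * r - 2) *
            (q : ℚ) ^ ((2 * r + 2) * (ν - 2 * r - 2))))) ∧
    (∀ r : ℕ, ∀ b : F, 1 ≤ r → 2 * r ≤ ν → b ∈ Ω →
      OrthSuborbit.HasSuborbitLength z (OrthSuborbit.φ₇ ν z r b)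
        (2 * (OrthSuborbit.cardGL F ν : ℚ) /
          (OrthSuborbit.cardSp F (r - 1) * OrthSuborbit.cardGL F (ν - 2 * r) *
            (q : ℚ) ^ (2 * r * (ν - 2 * r))))) ∧
    (∀ r : ℕ, 2 ≤ r → 2 * r ≤ ν →
      OrthSuborbit.HasSuborbitLength z (OrthSuborbit.φ₈ ν z r)
        ((OrthSuborbit.cardGL F ν : ℚ) /
          (OrthSuborbit.cardSp F (r - 2) * OrthSuborbit.cardGL F (ν - 2 * r) *
            (q : ℚ) ^ (2 * r * (ν - 2 * r) + 4 * r - 5)))) := by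
  subst hq
  have h2 := OrthSuborbit.two_ne_zero_of_odd_card hodd
  simp only [← Nat.card_eq_fintype_card]
  refine ⟨fun r hr h => ?_, fun r a h ha => ?_, fun r a hr h ha => ?_, fun r hr h => ?_,
    fun h => ?_, fun r hr h => ?_, fun r _ h => ?_, fun r b hr h hb => ?_, fun r hr h => ?_⟩
  · exact OrthSuborbit.length_φ₁ hz h2 hr (by omega)
  · exact OrthSuborbit.length_φ₂ hz h2 ha (by omega)
  · obtain ⟨r, rfl⟩ := Nat.exists_eq_add_of_le' hr
    exact OrthSuborbit.length_φ₃ hz h2 ha (by omega)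
  · obtain ⟨r, rfl⟩ := Nat.exists_eq_add_of_le' hr
    obtain ⟨m, rfl⟩ := Nat.exists_eq_add_of_le' h
    have e : (2 * (r + 1) + 1) * (m + (2 * (r + 1) + 1) - 2 * (r + 1)) - 2 =
        (2 * r + 3) * m + (2 * r + 1) := by
      rw [show m + (2 * (r + 1) + 1) - 2 * (r + 1) = m + 1 by omega]
      exact Nat.sub_eq_of_eq_add (by ring)
    rw [e, show m + (2 * (r + 1) + 1) - 2 * (r + 1) - 1 = m by omega]
    exact OrthSuborbit.length_φ₄ hz h2 (by omega)
  · have e : OrthSuborbit.φ₄ ν z 0 = OrthSuborbit.φ₆ ν z 0 := by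
      simp [OrthSuborbit.φ₄, OrthSuborbit.φ₆, OrthSuborbit.alt]
    rw [e]
    simpa [OrthSuborbit.cardSp_zero] using
      OrthSuborbit.length_φ₆ (r := 0) (m := ν - 2) hz h2 (by omega)
  · obtain ⟨r, rfl⟩ := Nat.exists_eq_add_of_le' hr
    obtain ⟨m, rfl⟩ := Nat.exists_eq_add_of_le' h
    have e : (2 * (r + 1) + 1) * (m + (2 * (r + 1) + 1) - 2 * (r + 1)) - 2 =
        (2 * r + 3) * m + (2 * r + 1) := by
      rw [show m + (2 * (r + 1) + 1) - 2 * (r + 1) = m + 1 by omega]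
      exact Nat.sub_eq_of_eq_add (by ring)
    rw [e, show m + (2 * (r + 1) + 1) - 2 * (r + 1) - 1 = m by omega]
    exact OrthSuborbit.length_φ₅ hz h2 (by omega)
  · exact OrthSuborbit.length_φ₆ hz h2 (by omega)
  · obtain ⟨r, rfl⟩ := Nat.exists_eq_add_of_le' hr
    exact OrthSuborbit.length_φ₇ hz h2 ((hΩ b).mpr (Or.inl hb)) (by omega)
  · obtain ⟨r, rfl⟩ := Nat.exists_eq_add_of_le' hr
    exact OrthSuborbit.length_φ₈ hz h2 (by omega)
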